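/- Let $\Omega\subset\mathbb R^N$ be open. Let $H^1(\Omega)$ be the real Sobolev space of all $u\in L^2(\Omega)$ with weak gradient $\nabla u\in L^2(\Omega;\mathbb R^N)$, put $$\mathcal E(u,v)=\int_\Omega\nabla u\cdot\nabla v\,dx,\qquad \mathcal E_1(u,v)=\mathcal E(u,v)+\int_\Omega uv\,dx ,$$ and let $\widetilde H^1(\Omega)$ be the closure of $H^1(\Omega)\cap C_c(\overline\Omega)$ in $H^1(\Omega)$. For a relatively open $A\subset\overline\Omega$ let $$\mathrm{Cap}_{\overline\Omega}(A)=\inf\{\mathcal E_1(u,u): u\in\widetilde H^1(\Omega),\ u\ge 1\text{ a.e. on }A\cap\Omega\}$$ (with $\inf\emptyset=\infty$), and for arbitrary $A\subset\overline\Omega$ let $\mathrm{Cap}_{\overline\Omega}(A)$ be the infimum of $\mathrm{Cap}_{\overline\Omega}(B)$ over the relatively open $B$ with $A\subset B\subset\overline\Omega$. A function $g:\overline\Omega\to\mathbb R$ is relatively quasi-continuous if for every $\varepsilon>0$ there is a relatively open $G\subset\overline\Omega$ with $\mathrm{Cap}_{\overline\Omega}(G)<\varepsilon$ such that $g|_{\overline\Omega\setminus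 G}$ is continuous. For $u\in\widetilde H^1(\Omega)$ let $\widetilde u$ denote its relatively quasi-continuous representative, which is unique up to a set of zero relative capacity. Let $S(\partial\Omega)$ be the set of the (positive) Borel measures $\mu$ on $\partial\Omega$ that vanish on all sets of zero relative capacity and for which there is an increasing sequence of closed sets $F_n\subset\partial\Omega$ with $\mu(F_n)<\infty$ for every $n$ and $\lim_{n\to\infty}\mathrm{Cap}_{\overline\Omega}(K\setminus F_n)=0$ for every compact $K\subset\partial\Omega$. Let $\mu\in S(\partial\Omega)$ be finite and let $\mathcal F^\mu=\{u\in\widetilde H^1(\Omega):\widetilde u\in L^2(\partial\Omega,\mu)\}$. For $k\in\{1,2,\dots\}$ let $$\mathcal E^{\mu_k}(u,v)=\int_\Omega\nabla u\cdot\nabla v\,dx+\frac1k\int_{\partial\Omega}\widetilde u\,\widetilde v\,d\mu,\qquad u,v\in\mathcal F^\mu .$$ Then there are self-adjoint operators $\Delta_{\mu_k}\ge 0$ (the Robin Laplacians) and $\Delta_N\ge 0$ (the Neumann Laplacian) on $L^2(\Omega)$ associated with the forms $(\mathcal E^{\mu_k},\mathcal F^\mu)$ and $(\mathcal E,\widetilde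 H^1(\Omega))$. (The operator $A$ associated with a form $(a,D)$ is given by: $u\in\mathrm{dom}(A)$ and $Au=f$ if and only if $u\in D$ and $a(u,v)=\int_\Omega fv\,dx$ for all $v\in D$.) Moreover $\Delta_{\mu_k}\to\Delta_N$ in the strong resolvent sense as $k\to\infty$: for every $\alpha>0$ the bounded inverses $(\Delta_{\mu_k}+\alpha)^{-1}$ and $(\Delta_N+\alpha)^{-1}$ exist on $L^2(\Omega)$, and $(\Delta_{\mu_k}+\alpha)^{-1}f\to(\Delta_N+\alpha)^{-1}f$ in $L^2(\Omega)$ for every $f\in L^2(\Omega)$. -/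

import Mathlib

open MeasureTheory Filter Topology
open scoped ENNReal ContDiff

noncomputable section

namespace Robin

/-- `ℝ^N` with the Euclidean norm. -/
abbrev E (N : ℕ) : Type := EuclideanSpace ℝ (Fin N)

variable {N : ℕ}

/-- The real Hilbert space `L²(Ω)`. -/
abbrev L2 (Ω : Set (E N)) : Type := Lp ℝ 2 ((volume : Measure (E N)).restrict Ω)

/-- The space `L²(Ω; ℝ^N)` of square integrable vector fields. -/
abbrev L2Vec (Ω : Set (E N)) : Type := Lp (E N) 2 ((volume : Measure (E N)).restrict Ω)

/-- `G` is the weak gradient of `u` on `Ω`: integration by parts against every test function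
`φ ∈ C_c^∞(Ω)`, in every coordinate direction. -/
def IsWeakGradient (Ω : Set (E N)) (u : L2 Ω) (G : L2Vec Ω) : Prop :=
  ∀ φ : E N → ℝ, ContDiff ℝ ∞ φ → HasCompactSupport φ → tsupport φ ⊆ Ω → ∀ i : Fin N,
    ∫ x in Ω, u x * fderiv ℝ φ x (EuclideanSpace.single i 1) = -∫ x in Ω, G x i * φ x

/-- The Sobolev space `H¹(Ω)`, as a subset of `L²(Ω)`. -/
def H1 (Ω : Set (E N)) : Set (L2 Ω) := {u | ∃ G : L2Vec Ω, IsWeakGradient Ω u G}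

open Classical in
/-- The weak gradient `∇u` of `u ∈ H¹(Ω)` (and `0` if `u ∉ H¹(Ω)`). -/
def weakGrad (Ω : Set (E N)) (u : L2 Ω) : L2Vec Ω :=
  if h : ∃ G : L2Vec Ω, IsWeakGradient Ω u G then h.choose else 0

/-- `𝓔(u, v) = ∫_Ω ∇u · ∇v dx`. -/
def dirichletForm (Ω : Set (E N)) (u v : L2 Ω) : ℝ :=
  ∫ x in Ω, inner ℝ (weakGrad Ω u x) (weakGrad Ω v x)

/-- `𝓔₁(u, v) = 𝓔(u, v) + (u, v)_{L²(Ω)}`, the inner product of `H¹(Ω)`. -/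
def energyOne (Ω : Set (E N)) (u v : L2 Ω) : ℝ :=
  dirichletForm Ω u v + ∫ x in Ω, u x * v x

/-- The class of `u : L²(Ω)` has a representative in `C_c(closure Ω)`, the continuous functions on
`closure Ω` that vanish outside some compact subset of it. -/
def HasCcRepresentative (Ω : Set (E N)) (u : L2 Ω) : Prop :=
  ∃ g : E N → ℝ, ContinuousOn g (closure Ω) ∧
    (∃ K : Set (E N), IsCompact K ∧ K ⊆ closure Ω ∧ ∀ x ∈ closure Ω \ K, g x = 0) ∧
    ∀ᵐ x ∂((volume : Measure (E N)).restrict Ω), u x = g x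

/-- `H̃¹(Ω)`, the closure of `H¹(Ω) ∩ C_c(closure Ω)` in `H¹(Ω)`. -/
def tildeH1 (Ω : Set (E N)) : Set (L2 Ω) :=
  {u | u ∈ H1 Ω ∧ ∀ ε : ℝ, 0 < ε →
    ∃ w ∈ H1 Ω, HasCcRepresentative Ω w ∧ energyOne Ω (u - w) (u - w) < ε}

/-- The relative capacity of a relatively open set `A ⊆ closure Ω`:
the infimum of `𝓔₁(u, u)` over `u ∈ H̃¹(Ω)` with `u ≥ 1` almost everywhere on `A`, where
`closure Ω` carries the measure `B ↦ volume (B ∩ Ω)`. It is `∞` if there is no such `u`. -/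
def relCapOpen (Ω A : Set (E N)) : ℝ≥0∞ :=
  ⨅ u : {u : L2 Ω // u ∈ tildeH1 Ω ∧
      ∀ᵐ x ∂((volume : Measure (E N)).restrict Ω), x ∈ A → 1 ≤ u x},
    ENNReal.ofReal (energyOne Ω (u : L2 Ω) (u : L2 Ω))

/-- The relative capacity of an arbitrary `A ⊆ closure Ω`: the infimum of the capacities of the
relatively open sets `closure Ω ∩ U` (with `U` open in `ℝ^N`) that contain `A`. -/
def relCap (Ω A : Set (E N)) : ℝ≥0∞ :=
  ⨅ U : {U : Set (E N) // IsOpen U ∧ A ⊆ closure Ω ∩ U},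
    relCapOpen Ω (closure Ω ∩ (U : Set (E N)))

/-- Relative quasi-continuity of a function on `closure Ω`
(values outside `closure Ω` are irrelevant). -/
def IsRelQuasiContinuous (Ω : Set (E N)) (g : E N → ℝ) : Prop :=
  ∀ ε : ℝ≥0∞, 0 < ε → ∃ U : Set (E N), IsOpen U ∧ relCap Ω (closure Ω ∩ U) < ε ∧
    ContinuousOn g (closure Ω \ U)

/-- `g` is a relatively quasi-continuous representative of `u`. -/
def IsRqcRep (Ω : Set (E N)) (u : L2 Ω) (g : E N → ℝ) : Prop :=
  IsRelQuasiContinuous Ω g ∧ ∀ᵐ x ∂((volume : Measure (E N)).restrict Ω), g x = u x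

open Classical in
/-- The relatively quasi-continuous representative `ũ` of `u ∈ H̃¹(Ω)`; it is determined outside a
set of zero relative capacity (and set to `0` for a `u` that has none). -/
def rqcRep (Ω : Set (E N)) (u : L2 Ω) : E N → ℝ :=
  if h : ∃ g : E N → ℝ, IsRqcRep Ω u g then h.choose else 0

/-- Smooth measures on `∂Ω`, the class `S(∂Ω)`. A Borel measure on the closed set `∂Ω` is
represented by a Borel measure on `ℝ^N` for which the complement of `∂Ω` is null. -/
structure IsSmoothMeasure (Ω : Set (E N)) (μ : Measure (E N)) : Prop where
  concentrated : μ (frontier Ω)ᶜ = 0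
  null_of_relCap_zero : ∀ A : Set (E N), A ⊆ frontier Ω → MeasurableSet A →
    relCap Ω A = 0 → μ A = 0
  exists_nest : ∃ F : ℕ → Set (E N), Monotone F ∧
    (∀ n, IsClosed (F n) ∧ F n ⊆ frontier Ω ∧ μ (F n) < ⊤) ∧
    ∀ K : Set (E N), IsCompact K → K ⊆ frontier Ω →
      Tendsto (fun n => relCap Ω (K \ F n)) atTop (𝓝 0)

/-- The form domain `𝓕^μ = H̃¹(Ω) ∩ L²(∂Ω, μ)`. -/
def robinDomain (Ω : Set (E N)) (μ : Measure (E N)) : Set (L2 Ω) :=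
  {u | u ∈ tildeH1 Ω ∧ MemLp (rqcRep Ω u) 2 (μ.restrict (frontier Ω))}

variable {H : Type*} [NormedAddCommGroup H] [InnerProductSpace ℝ H]

/-- `A` is the operator associated with the symmetric form `a` with domain `D`: `u ∈ dom A` and
`A u = f` exactly when `u ∈ D` and `a(u, v) = (f, v)` for every `v ∈ D`. Thus `A ≥ 0` if `a ≥ 0`,
and `A` generates the semigroup `e^{-tA}`. The condition describes the graph of `A`, so there is
at most one such `A`. -/
def IsFormOperator (D : Set H) (a : H → H → ℝ) (A : H →ₗ.[ℝ] H) : Prop :=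
  ∀ u f : H, (u, f) ∈ A.graph ↔ u ∈ D ∧ ∀ v ∈ D, a u v = inner ℝ f v

/-- `R` is the bounded two-sided inverse `(A + α)⁻¹` of `A + α : dom A → H`. -/
def IsResolventAt (A : H →ₗ.[ℝ] H) (α : ℝ) (R : H →L[ℝ] H) : Prop :=
  (∀ f : H, ∃ h : R f ∈ A.domain, A ⟨R f, h⟩ + α • R f = f) ∧
    ∀ u : A.domain, R (A u + α • (u : H)) = u

/-- Strong resolvent convergence of nonnegative self-adjoint operators: for every `α > 0` the
resolvents `(A i + α)⁻¹` and `(B + α)⁻¹` exist, and `(A i + α)⁻¹ f → (B + α)⁻¹ f` for every `f`. -/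
def StrongResolventTendsto {ι : Type*} (A : ι → H →ₗ.[ℝ] H) (l : Filter ι)
    (B : H →ₗ.[ℝ] H) : Prop :=
  ∀ α : ℝ, 0 < α → ∃ (R : ι → H →L[ℝ] H) (S : H →L[ℝ] H),
    (∀ i, IsResolventAt (A i) α (R i)) ∧ IsResolventAt B α S ∧
      ∀ f : H, Tendsto (fun i => R i f) l (𝓝 (S f))

end Robin

end

/-! For fixed `f` and `α`, the functions `u_k = (Δ_{μ_k} + α)⁻¹ f` and `u₀ = (Δ_N + α)⁻¹ f` solve
variational problems that differ only in the boundary term `b / k`, where `b(u, v) = ∫ ũ ṽ dμ`. With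
`C = 𝓔 + α (·, ·)`, testing against `u_k - w` gives `C(u_k - u₀, u_k - u₀) ≤ b(w, w) / k + C(w - u₀,
w - u₀)` for every `w ∈ 𝓕^μ`. If `𝓕^μ` is dense in `H̃¹(Ω)`, choose `w` near `u₀` and then `k` large
(`tendsto_of_vanishing_perturbation`). Density holds because `μ` is finite: functions in `H¹ ∩ C_c`
have bounded boundary values, so they lie in `𝓕^μ`.

Most of the work goes into the existence of the operators. `exists_formOperator` derives it by
Lax-Milgram from completeness of the form domain. For `𝓕^μ`, completeness (`isClosed_robinGraph`)
requires that convergence in `H̃¹` force `μ`-a.e. convergence of the quasi-continuous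
representatives along a subsequence. This comes from the weak type capacity estimate
`IsRqcRep.sqrtCapLE` and Borel-Cantelli, since `μ` does not charge sets of zero capacity. Those
capacity arguments use nonnegative potentials, hence `|u| ∈ H̃¹` with no larger norm: the chain
rule, proved by mollification, is applied to `√(t² + ε²) - ε`, and weak compactness lets `ε → 0`. -/

noncomputable section

namespace Robin

/-! ### Abstract closed forms, their operators and resolvents, and weak compactness. -/

section FormOperators

variable {V H : Type*} [NormedAddCommGroup V] [InnerProductSpace ℝ V]
  [NormedAddCommGroup H] [InnerProductSpace ℝ H]

/-- Solutions of the problems of the forms `B + b / k` on a dense subspace converge to the solution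
of the problem of the form `B`. -/
theorem tendsto_of_vanishing_perturbation {W : Type*} [AddCommGroup W] [Module ℝ W]
    (ι : V →L[ℝ] H) (B : V →L[ℝ] V →L[ℝ] ℝ) (hsymm : ∀ u v, B u v = B v u)
    (hnonneg : ∀ u, 0 ≤ B u u) (j : W →ₗ[ℝ] V) (hj : DenseRange j)
    (b : W →ₗ[ℝ] W →ₗ[ℝ] ℝ) (hbsymm : ∀ u v, b u v = b v u) (hbnonneg : ∀ u, 0 ≤ b u u)
    {α : ℝ} (hα : 0 < α) (f : H) (u : ℕ+ → W) (u₀ : V)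
    (hu : ∀ k : ℕ+, ∀ v, B (j (u k)) (j v) + (1 / (k : ℝ)) * b (u k) v +
      α * inner ℝ (ι (j (u k))) (ι (j v)) = inner ℝ f (ι (j v)))
    (hu₀ : ∀ v, B u₀ v + α * inner ℝ (ι u₀) (ι v) = inner ℝ f (ι v)) :
    Tendsto (fun k => ι (j (u k))) atTop (𝓝 (ι u₀)) := by
  let J : H →L[ℝ] H →L[ℝ] ℝ := innerSL ℝ
  obtain ⟨C, hC⟩ : ∃ C : V →L[ℝ] V →L[ℝ] ℝ, ∀ u v, C u v = B u v + α * inner ℝ (ι u) (ι v) :=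
    ⟨B + α • J.bilinearComp ι ι, fun u v => by
      simp only [J, add_apply, smul_apply, ContinuousLinearMap.bilinearComp_apply, smul_eq_mul]
      rfl⟩
  have hCsymm : ∀ u v, C u v = C v u := fun u v => by rw [hC, hC, hsymm, real_inner_comm]
  have hCge : ∀ u, α * ‖ι u‖ ^ 2 ≤ C u u := fun u => by
    rw [hC, real_inner_self_eq_norm_sq]; linarith [hnonneg u]
  have hCnonneg : ∀ u, 0 ≤ C u u := fun u => le_trans (by positivity) (hCge u)
  -- A Céa-type estimate: subtract the two equations, test with `u k - w`, and complete squares in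
  -- `C` and in `b`.
  have key : ∀ (k : ℕ+) (w : W), C (j (u k) - u₀) (j (u k) - u₀) ≤
      (1 / (k : ℝ)) * b w w + C (j w - u₀) (j w - u₀) := by
    intro k w
    have h1 : C (j (u k) - u₀) (j (u k - w)) = -((1 / (k : ℝ)) * b (u k) (u k - w)) := by
      have := hu k (u k - w)
      rw [← hu₀, ← hC] at this
      rw [map_sub C, sub_apply, hC]
      linarith
    have h2 : j (u k - w) = (j (u k) - u₀) - (j w - u₀) := by rw [map_sub]; abel
    rw [h2] at h1
    generalize j (u k) - u₀ = z at h1 ⊢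
    generalize j w - u₀ = d at h1 ⊢
    have h3 := hCnonneg (z - d)
    -- The half completes the square: `b(u_k, u_k) - b(u_k, w) ≥ -b(w, w) / 4`.
    have h4 := hbnonneg (u k - (1 / 2 : ℝ) • w)
    have h5 := hbnonneg w
    simp only [map_sub, sub_apply, LinearMap.sub_apply, map_smul,
      LinearMap.smul_apply, smul_eq_mul] at h1 h3 h4
    rw [hCsymm d z] at h3
    rw [hbsymm w (u k)] at h4
    have h6 : 0 ≤ (1 / (k : ℝ)) * (b (u k) (u k) - b (u k) w + b w w / 4) :=
      mul_nonneg (by positivity) (by linarith)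
    have h7 : 0 ≤ (1 / (k : ℝ)) * b w w := mul_nonneg (by positivity) h5
    linarith
  rw [Metric.tendsto_atTop]
  intro ε hε
  have hcont : Continuous fun v => C (v - u₀) (v - u₀) := by fun_prop
  -- `w` is fixed before `k`, so it does not matter how large `b w w` is.
  obtain ⟨w, hw⟩ : ∃ w, C (j w - u₀) (j w - u₀) < α * ε ^ 2 / 2 := by
    refine hj.exists_mem_open (isOpen_Iio.preimage hcont) ⟨u₀, ?_⟩
    simp only [Set.mem_preimage, Set.mem_Iio, sub_self, map_zero]
    positivity
  obtain ⟨n, hn⟩ := exists_nat_gt (b w w / (α * ε ^ 2 / 2))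
  refine ⟨⟨n + 1, n.succ_pos⟩, fun k hk => ?_⟩
  have hk' : (n : ℝ) < k := by
    have : n + 1 ≤ (k : ℕ) := hk
    exact_mod_cast this
  have hk0 : (0 : ℝ) < k := by positivity
  have h1 : (1 / (k : ℝ)) * b w w < α * ε ^ 2 / 2 := by
    rw [one_div, inv_mul_lt_iff₀ hk0]
    rw [div_lt_iff₀ (by positivity)] at hn
    exact hn.trans (mul_lt_mul_of_pos_right hk' (by positivity))
  have h2 := hCge (j (u k) - u₀)
  have h3 := key k w
  have h4 : α * ‖ι (j (u k) - u₀)‖ ^ 2 < α * ε ^ 2 := by linarith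
  rw [dist_eq_norm, ← map_sub]
  exact lt_of_pow_lt_pow_left₀ 2 hε.le (lt_of_mul_lt_mul_left h4 hα.le)

variable [CompleteSpace V] [CompleteSpace H]

/-- A symmetric operator `A` for which `A + 1` is onto is self-adjoint. -/
theorem isSelfAdjoint_of_surjective (A : H →ₗ.[ℝ] H) (hdense : Dense (A.domain : Set H))
    (hsymm : ∀ u v : A.domain, inner ℝ (A u) (v : H) = inner ℝ (u : H) (A v))
    (hsurj : ∀ f : H, ∃ u : A.domain, A u + (u : H) = f) : IsSelfAdjoint A := by
  rw [LinearPMap.isSelfAdjoint_def]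
  have hle : A ≤ A.adjoint :=
    LinearPMap.IsFormalAdjoint.le_adjoint hdense fun u v => hsymm u v
  refine (LinearPMap.eq_of_le_of_domain_eq hle (le_antisymm hle.1 fun y hy => ?_)).symm
  -- Solve `(A + 1) z = (A* + 1) y`. By symmetry `y - z` is then orthogonal to the range of `A + 1`,
  -- which is everything.
  obtain ⟨z, hz⟩ := hsurj (A.adjoint ⟨y, hy⟩ + y)
  suffices h : y = z by rw [h]; exact z.2
  have key : ∀ u : A.domain, inner ℝ (A u + (u : H)) (y - z) = 0 := fun u => by
    have h1 := LinearPMap.adjoint_isFormalAdjoint hdense ⟨y, hy⟩ u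
    have h2 := hsymm u z
    have h3 : inner ℝ (u : H) (A z + (z : H)) = inner ℝ (u : H) (A.adjoint ⟨y, hy⟩ + y) := by
      rw [hz]
    rw [real_inner_comm] at h1
    rw [inner_add_right, inner_add_right] at h3
    rw [inner_sub_right, inner_add_left, inner_add_left, h2]
    rw [real_inner_comm] at h1
    have h4 := real_inner_comm (A u) y
    have h5 := real_inner_comm (u : H) (A.adjoint ⟨y, hy⟩)
    simp only at h1
    linarith
  obtain ⟨u, hu⟩ := hsurj (y - z)
  have := key u
  rw [hu, inner_self_eq_zero] at this
  exact sub_eq_zero.1 this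

/-- The bounded operator `f ↦ u`, where `B(u, v) + α (u, v) = (f, v)` for all `v`. -/
theorem exists_resolvent (ι : V →L[ℝ] H) (B : V →L[ℝ] V →L[ℝ] ℝ) (hnonneg : ∀ u, 0 ≤ B u u)
    {c : ℝ} (hc : 0 < c) (hcoer : ∀ u, c * ‖u‖ ^ 2 ≤ B u u + ‖ι u‖ ^ 2) {α : ℝ} (hα : 0 < α) :
    ∃ T : H →L[ℝ] V, ∀ f v, B (T f) v + α * inner ℝ (ι (T f)) (ι v) = inner ℝ f (ι v) := by
  let J : H →L[ℝ] H →L[ℝ] ℝ := innerSL ℝ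
  let C : V →L[ℝ] V →L[ℝ] ℝ := B + α • J.bilinearComp ι ι
  have hC : ∀ u v, C u v = B u v + α * inner ℝ (ι u) (ι v) := fun u v => by
    simp only [C, J, add_apply, smul_apply, ContinuousLinearMap.bilinearComp_apply, smul_eq_mul]
    rfl
  have hcoerC : IsCoercive C := by
    -- `B + α ‖ι ·‖²` dominates `min 1 α` times the form bounded below in `hcoer`.
    refine ⟨min 1 α * c, by positivity, fun u => ?_⟩
    rw [hC, real_inner_self_eq_norm_sq]
    have h1 : min 1 α * (c * ‖u‖ ^ 2) ≤ min 1 α * (B u u + ‖ι u‖ ^ 2) :=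
      mul_le_mul_of_nonneg_left (hcoer u) (by positivity)
    have h2 : min 1 α * B u u ≤ 1 * B u u :=
      mul_le_mul_of_nonneg_right (min_le_left _ _) (hnonneg u)
    have h3 : min 1 α * ‖ι u‖ ^ 2 ≤ α * ‖ι u‖ ^ 2 :=
      mul_le_mul_of_nonneg_right (min_le_right _ _) (by positivity)
    nlinarith
  let S := hcoerC.continuousLinearEquivOfBilin
  refine ⟨(S.symm : V →L[ℝ] V).comp (ContinuousLinearMap.adjoint ι), fun f v => ?_⟩
  rw [← hC, ← hcoerC.continuousLinearEquivOfBilin_apply]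
  have : S (S.symm (ContinuousLinearMap.adjoint ι f)) = ContinuousLinearMap.adjoint ι f := by simp
  change inner ℝ (S (S.symm (ContinuousLinearMap.adjoint ι f))) v = _
  rw [this, ContinuousLinearMap.adjoint_inner_left]

/-- A densely defined closed nonnegative symmetric form has a self-adjoint operator, whose
resolvents are given by the variational problems of the form. -/
theorem exists_formOperator (ι : V →L[ℝ] H) (hd : DenseRange ι)
    (B : V →L[ℝ] V →L[ℝ] ℝ) (hsymm : ∀ u v, B u v = B v u) (hnonneg : ∀ u, 0 ≤ B u u)
    {c : ℝ} (hc : 0 < c) (hcoer : ∀ u, c * ‖u‖ ^ 2 ≤ B u u + ‖ι u‖ ^ 2)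
    {D : Set H} (hD : D = Set.range ι) {a : H → H → ℝ} (ha : ∀ u v, a (ι u) (ι v) = B u v) :
    ∃ A : H →ₗ.[ℝ] H, IsSelfAdjoint A ∧ IsFormOperator D a A ∧
      ∀ α : ℝ, 0 < α → ∃ R : H →L[ℝ] H, IsResolventAt A α R ∧
        ∀ f, ∃ u, R f = ι u ∧ ∀ v, B u v + α * inner ℝ (ι u) (ι v) = inner ℝ f (ι v) := by
  let Γ : Submodule ℝ (H × H) :=
    { carrier := {p | ∃ u, ι u = p.1 ∧ ∀ v, B u v = inner ℝ p.2 (ι v)}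
      zero_mem' := ⟨0, by simp⟩
      add_mem' := by
        rintro ⟨x, f⟩ ⟨y, g⟩ ⟨u, hu, hu'⟩ ⟨v, hv, hv'⟩
        refine ⟨u + v, by rw [map_add, hu, hv]; rfl, fun w => ?_⟩
        simp [inner_add_left, hu', hv']
      smul_mem' := by
        rintro r ⟨x, f⟩ ⟨u, hu, hu'⟩
        exact ⟨r • u, by rw [map_smul, hu]; rfl, fun w => by simp [inner_smul_left, hu']⟩ }
  have hdef : ∀ u β, 0 < β → B u u + β * ‖ι u‖ ^ 2 ≤ 0 → u = 0 := fun u β hβ hu => by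
    have h1 : β * ‖ι u‖ ^ 2 ≤ 0 := by linarith [hnonneg u]
    have h2 : ‖ι u‖ ^ 2 ≤ 0 := nonpos_of_mul_nonpos_right h1 hβ
    have h3 : c * ‖u‖ ^ 2 ≤ 0 := (hcoer u).trans (by nlinarith [sq_nonneg ‖ι u‖])
    have h4 : ‖u‖ ^ 2 ≤ 0 := nonpos_of_mul_nonpos_right h3 hc
    simpa using le_antisymm h4 (sq_nonneg _)
  -- Injectivity is hidden in `ha`: as `B` factors through `ι`, a kernel vector has `B u u = B 0 0 =
  -- 0`, and coercivity finishes.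
  have hinj : ∀ u, ι u = 0 → u = 0 := fun u hu => by
    refine hdef u 1 one_pos ?_
    have h1 := ha u u
    have h2 := ha 0 0
    rw [map_zero, ← hu, h1] at h2
    simp [h2, hu]
  have hzero : ∀ f : H, (∀ v, inner ℝ f (ι v) = 0) → f = 0 := fun f hf =>
    hd.eq_zero_of_inner_left ℝ hf
  have hΓ : ∀ x ∈ Γ, x.1 = 0 → x.2 = 0 := by
    rintro ⟨x, f⟩ ⟨u, hu, hu'⟩ hx
    refine hzero f fun v => ?_
    rw [← hu', hinj u (hu.trans hx)]
    simp
  let A := Γ.toLinearPMap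
  have hA : A.graph = Γ := Submodule.toLinearPMap_graph_eq Γ hΓ
  have hmem : ∀ (x f : H), (x, f) ∈ A.graph ↔
      ∃ u, ι u = x ∧ ∀ v, B u v = inner ℝ f (ι v) := fun x f => by rw [hA]; rfl
  have happ : ∀ (u f : H), (u, f) ∈ A.graph → ∃ h : u ∈ A.domain, A ⟨u, h⟩ = f := by
    intro u f h
    obtain ⟨⟨y, hy₀⟩, hy, hy'⟩ := (LinearPMap.mem_graph_iff A).1 h
    simp only at hy hy'
    subst hy
    exact ⟨hy₀, hy'⟩
  have hres : ∀ α : ℝ, 0 < α → ∃ R : H →L[ℝ] H, IsResolventAt A α R ∧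
      ∀ f, ∃ u, R f = ι u ∧ ∀ v, B u v + α * inner ℝ (ι u) (ι v) = inner ℝ f (ι v) := by
    intro α hα
    obtain ⟨T, hT⟩ := exists_resolvent ι B hnonneg hc hcoer hα
    refine ⟨ι.comp T, ⟨fun f => ?_, fun u => ?_⟩, fun f => ⟨T f, rfl, hT f⟩⟩
    · obtain ⟨h, h'⟩ := happ (ι (T f)) (f - α • ι (T f)) ((hmem _ _).2 ⟨T f, rfl, fun v => by
        rw [inner_sub_left, ← hT f v, real_inner_smul_left]; ring⟩)
      exact ⟨h, by
        change A ⟨ι (T f), h⟩ + α • ι (T f) = f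
        rw [h']; abel⟩
    · obtain ⟨x, hx, hx'⟩ := (hmem u (A u)).1 (A.mem_graph u)
      -- The difference solves the homogeneous problem; test it with itself.
      have : T (A u + α • (u : H)) - x = 0 := by
        refine hdef _ α hα (le_of_eq ?_)
        have h1 := hT (A u + α • (u : H)) (T (A u + α • (u : H)) - x)
        generalize T (A u + α • (u : H)) = t at h1 ⊢
        rw [inner_add_left, real_inner_smul_left, ← hx', ← hx, map_sub ι t x] at h1
        rw [← real_inner_self_eq_norm_sq, map_sub ι t x, inner_sub_left, map_sub B t x, sub_apply]
        linarith
      rw [ContinuousLinearMap.comp_apply, sub_eq_zero.1 this, hx]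
  obtain ⟨R, hR, hRT⟩ := hres 1 one_pos
  refine ⟨A, isSelfAdjoint_of_surjective A ?_ (fun u v => ?_) (fun f => ?_), fun u f => ?_, hres⟩
  -- If `w` is orthogonal to the domain, it is orthogonal to `R w = ι u`, so `B u u + ‖ι u‖² = 0`.
  -- Hence `u = 0`, and `w` annihilates the dense range of `ι`.
  · rw [Submodule.dense_iff_topologicalClosure_eq_top, Submodule.topologicalClosure_eq_top_iff,
      Submodule.eq_bot_iff]
    intro w hw
    obtain ⟨u, hu, hu'⟩ := hRT w
    have h0 : inner ℝ w (ι u) = 0 := by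
      rw [← hu]; exact (Submodule.mem_orthogonal' _ _).1 hw _ (hR.1 w).1
    have hu0 : u = 0 := hdef u 1 one_pos (by rw [← real_inner_self_eq_norm_sq, hu', h0])
    exact hzero w fun v => by rw [← hu', hu0]; simp
  · obtain ⟨x, hx, hx'⟩ := (hmem u (A u)).1 (A.mem_graph u)
    obtain ⟨y, hy, hy'⟩ := (hmem v (A v)).1 (A.mem_graph v)
    rw [← hy, ← hx', hsymm, hy', ← hx, real_inner_comm]
  · obtain ⟨h, h'⟩ := hR.1 f
    exact ⟨⟨R f, h⟩, by simpa using h'⟩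
  · rw [hmem, hD]
    constructor
    · rintro ⟨x, rfl, hx⟩
      refine ⟨⟨x, rfl⟩, ?_⟩
      rintro _ ⟨y, rfl⟩
      rw [ha, hx]
    · rintro ⟨⟨x, rfl⟩, hx⟩
      exact ⟨x, rfl, fun v => by rw [← ha]; exact hx _ ⟨v, rfl⟩⟩

/-- If the images of a bounded sequence under a continuous linear map converge, the limit is the
image of an element with the same bound. -/
theorem exists_eq_of_bounded_of_tendsto (T : V →L[ℝ] H) {C : ℝ} {v : ℕ → V}
    (hC : ∀ n, ‖v n‖ ≤ C) {h : H} (hh : Tendsto (fun n => T (v n)) atTop (𝓝 h)) :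
    ∃ w, ‖w‖ ≤ C ∧ T w = h := by
  let φ : ℕ → WeakDual ℝ V := fun n => (InnerProductSpace.toDual ℝ V (v n)).toWeakDual
  have hφ : ∀ n y, φ n y = inner ℝ (v n) y := fun n y => rfl
  -- Banach-Alaoglu along a nonprincipal ultrafilter; no subsequence or separability is needed.
  let U : Ultrafilter (WeakDual ℝ V) := (hyperfilter ℕ).map φ
  obtain ⟨ψ, hψ, hU⟩ := (WeakDual.isCompact_closedBall (0 : StrongDual ℝ V) C).ultrafilter_le_nhds
    U (by
      rw [le_principal_iff]
      exact Filter.mem_map.2 (Filter.univ_mem' fun n => by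
        simpa [φ] using hC n))
  have hconv : Tendsto φ (hyperfilter ℕ : Filter ℕ) (𝓝 ψ) := hU
  refine ⟨(InnerProductSpace.toDual ℝ V).symm (WeakDual.toStrongDual ψ), by simpa using hψ,
    ext_inner_right ℝ fun f => ?_⟩
  rw [← ContinuousLinearMap.adjoint_inner_right, InnerProductSpace.toDual_symm_apply]
  have h1 : Tendsto (fun n => φ n (ContinuousLinearMap.adjoint T f)) (hyperfilter ℕ : Filter ℕ)
      (𝓝 (ψ (ContinuousLinearMap.adjoint T f))) :=
    ((WeakDual.eval_continuous _).tendsto ψ).comp hconv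
  have h2 : Tendsto (fun n => inner ℝ (T (v n)) f) (hyperfilter ℕ : Filter ℕ) (𝓝 (inner ℝ h f)) :=
    (hh.mono_left (Nat.hyperfilter_le_atTop)).inner tendsto_const_nhds
  refine tendsto_nhds_unique h1 (h2.congr fun n => ?_)
  rw [hφ, ContinuousLinearMap.adjoint_inner_right]

end FormOperators

/-! ### Mollification and the chain rule for weak derivatives. -/

section Mollification

open ContinuousLinearMap Metric

variable {X : Type*} [NormedAddCommGroup X] [InnerProductSpace ℝ X] [FiniteDimensional ℝ X]
  [MeasurableSpace X] [BorelSpace X]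

/-- The mollification of `g` by a normalized bump function. -/
abbrev mollify (φ : ContDiffBump (0 : X)) (g : X → ℝ) : X → ℝ :=
  convolution (φ.normed volume) g (lsmul ℝ ℝ) volume

theorem mollify_eq (φ : ContDiffBump (0 : X)) (g : X → ℝ) (x : X) :
    mollify φ g x = ∫ t, φ.normed volume (x - t) * g t :=
  convolution_lsmul_swap

theorem integrable_mollify (φ : ContDiffBump (0 : X)) {g : X → ℝ} (hg : Integrable g) :
    Integrable (mollify φ g) :=
  φ.integrable_normed.integrable_convolution _ hg

theorem contDiff_mollify (φ : ContDiffBump (0 : X)) {g : X → ℝ} (hg : Integrable g) :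
    ContDiff ℝ 1 (mollify φ g) :=
  φ.hasCompactSupport_normed.contDiff_convolution_left (n := 1) _ φ.contDiff_normed
    hg.locallyIntegrable

theorem mollify_sub (φ : ContDiffBump (0 : X)) {g h : X → ℝ} (hg : Integrable g)
    (hh : Integrable h) (x : X) : mollify φ (g - h) x = mollify φ g x - mollify φ h x := by
  have hex : ∀ {k : X → ℝ}, Integrable k → ConvolutionExistsAt (φ.normed volume) k x
      (lsmul ℝ ℝ : ℝ →L[ℝ] ℝ →L[ℝ] ℝ) volume := fun hk =>
    φ.hasCompactSupport_normed.convolutionExists_left _ φ.continuous_normed hk.locallyIntegrable x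
  have h := (hex (hg.sub hh)).distrib_add (hex hh)
  rw [sub_add_cancel] at h
  exact eq_sub_of_add_eq h.symm

/-- The kernel is nonnegative of mass one, so `|φ ∗ g| ≤ φ ∗ |g|`, and the right side integrates to
`∫ |g|`. -/
theorem integral_norm_mollify_le (φ : ContDiffBump (0 : X)) {g : X → ℝ} (hg : Integrable g) :
    ∫ x, ‖mollify φ g x‖ ≤ ∫ x, ‖g x‖ := by
  have h1 : ∫ x, mollify φ (fun x => ‖g x‖) x = ∫ x, ‖g x‖ := by
    rw [integral_convolution _ φ.integrable_normed hg.norm, φ.integral_normed]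
    simp
  rw [← h1]
  refine integral_mono (integrable_mollify φ hg).norm (integrable_mollify φ hg.norm) fun x => ?_
  simp only [mollify_eq]
  refine (norm_integral_le_integral_norm _).trans_eq ?_
  simp only [norm_mul, Real.norm_of_nonneg (φ.nonneg_normed _)]

/-- Mollifications of an integrable function converge in `L¹` of every compact set. -/
theorem tendsto_setIntegral_mollify_sub {φ : ℕ → ContDiffBump (0 : X)}
    (hφ : Tendsto (fun n => (φ n).rOut) atTop (𝓝 0)) {g : X → ℝ} (hg : Integrable g)
    {K : Set X} (hK : IsCompact K) :
    Tendsto (fun n => ∫ x in K, ‖mollify (φ n) g x - g x‖) atTop (𝓝 0) := by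
  rw [Metric.tendsto_atTop]
  intro ε hε
  obtain ⟨h, hsupp, hgh, hcont, hint⟩ := hg.exists_hasCompactSupport_integral_sub_le
    (ε := ε / 3) (by positivity)
  have hunif := hsupp.uniformContinuous_of_continuous hcont
  set M := volume.real K with hM
  have hM0 : 0 ≤ M := measureReal_nonneg
  -- `M + 1` keeps the denominator positive when `K` is null; the `4` leaves slack in `ε/3 + ε/3 +
  -- ε/4 < ε`.
  obtain ⟨δ, hδ, hδ'⟩ := Metric.uniformContinuous_iff.1 hunif (ε / (4 * (M + 1))) (by positivity)
  obtain ⟨n₀, hn₀⟩ := eventually_atTop.1 (hφ.eventually (gt_mem_nhds hδ))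
  refine ⟨n₀, fun n hn => ?_⟩
  have hclose : ∀ x, ‖mollify (φ n) h x - h x‖ ≤ ε / (4 * (M + 1)) := fun x => by
    rw [← dist_eq_norm]
    refine ContDiffBump.dist_normed_convolution_le hcont.aestronglyMeasurable fun y hy => ?_
    exact (hδ' ((mem_ball.1 hy).trans (hn₀ n hn))).le
  have i1 : Integrable fun x => ‖mollify (φ n) (g - h) x‖ :=
    (integrable_mollify (φ n) (hg.sub hint)).norm
  have i2 : Integrable fun x => ‖g x - h x‖ := (hg.sub hint).norm
  have i3 : IntegrableOn (fun x => ‖mollify (φ n) h x - h x‖) K :=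
    ((integrable_mollify (φ n) hint).sub hint).norm.integrableOn
  have hle : ∫ x in K, ‖mollify (φ n) g x - g x‖ ≤
      ∫ x in K, (‖mollify (φ n) (g - h) x‖ + ‖mollify (φ n) h x - h x‖ + ‖g x - h x‖) := by
    refine integral_mono ((integrable_mollify (φ n) hg).sub hg).norm.integrableOn
      ((i1.integrableOn.add i3).add i2.integrableOn) fun x => ?_
    simp only [mollify_sub (φ n) hg hint]
    have : mollify (φ n) g x - g x = (mollify (φ n) g x - mollify (φ n) h x) +
      (mollify (φ n) h x - h x) - (g x - h x) := by ring
    rw [this]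
    exact (norm_sub_le _ _).trans (add_le_add_left (norm_add_le _ _) _)
  have i13 : IntegrableOn (fun x => ‖mollify (φ n) (g - h) x‖ + ‖mollify (φ n) h x - h x‖) K :=
    i1.integrableOn.add i3
  rw [integral_add i13 i2.integrableOn,
    integral_add i1.integrableOn i3] at hle
  have e1 : ∫ x in K, ‖mollify (φ n) (g - h) x‖ ≤ ε / 3 :=
    (setIntegral_le_integral i1 (Eventually.of_forall fun x => norm_nonneg _)).trans
      ((integral_norm_mollify_le (φ n) (hg.sub hint)).trans hgh)
  have e2 : ∫ x in K, ‖g x - h x‖ ≤ ε / 3 :=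
    (setIntegral_le_integral i2 (Eventually.of_forall fun x => norm_nonneg _)).trans hgh
  have e3 : ∫ x in K, ‖mollify (φ n) h x - h x‖ ≤ ε / 4 := by
    have h1 := norm_setIntegral_le_of_norm_le_const (f := fun x => ‖mollify (φ n) h x - h x‖)
      (hK.measure_lt_top (μ := volume)) (fun x _ => by rw [norm_norm]; exact hclose x)
    rw [Real.norm_of_nonneg (integral_nonneg fun x => norm_nonneg _)] at h1
    refine h1.trans ?_
    rw [← hM, div_mul_eq_mul_div, div_le_div_iff₀ (by positivity) (by positivity)]
    nlinarith
  rw [Real.dist_eq, sub_zero, abs_of_nonneg (integral_nonneg fun x => norm_nonneg _)]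
  linarith

/-- `g` is the weak derivative of `u` on `O` in direction `e`. -/
def HasWeakDeriv (O : Set X) (e : X) (u g : X → ℝ) : Prop :=
  ∀ φ : X → ℝ, ContDiff ℝ ∞ φ → HasCompactSupport φ → tsupport φ ⊆ O →
    ∫ x in O, u x * fderiv ℝ φ x e = -∫ x in O, g x * φ x

/-- With the next lemma, this moves an integral against a test function between any two sets
containing its support. -/
theorem setIntegral_mul_eq_integral {φ : X → ℝ} {S : Set X} (hS : tsupport φ ⊆ S) (k : X → ℝ) :
    ∫ x in S, k x * φ x = ∫ x, k x * φ x :=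
  setIntegral_eq_integral_of_forall_compl_eq_zero fun x hx => by
    rw [image_eq_zero_of_notMem_tsupport fun h => hx (hS h), mul_zero]

theorem setIntegral_mul_fderiv_eq_integral {φ : X → ℝ} {S : Set X} (hS : tsupport φ ⊆ S)
    (k : X → ℝ) (e : X) :
    ∫ x in S, k x * fderiv ℝ φ x e = ∫ x, k x * fderiv ℝ φ x e :=
  setIntegral_eq_integral_of_forall_compl_eq_zero fun x hx => by
    rw [image_eq_zero_of_notMem_tsupport fun h => hx (hS (tsupport_fderiv_subset ℝ h)), zero_apply,
      mul_zero]

theorem HasWeakDeriv.mono {O O' : Set X} {e : X} {u g : X → ℝ} (h : HasWeakDeriv O e u g)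
    (hO : O' ⊆ O) : HasWeakDeriv O' e u g := by
  intro φ hφ hc hs
  have := h φ hφ hc (hs.trans hO)
  rwa [setIntegral_mul_fderiv_eq_integral (hs.trans hO), setIntegral_mul_eq_integral (hs.trans hO),
    ← setIntegral_mul_fderiv_eq_integral hs, ← setIntegral_mul_eq_integral hs] at this

/-- Away from the boundary of `O`, the derivative of a mollification is the mollification of the
weak derivative. -/
theorem fderiv_mollify_apply {O : Set X} (hO : MeasurableSet O) {e : X} {u g : X → ℝ}
    (h : HasWeakDeriv O e u g) (hu : IntegrableOn u O) (φ : ContDiffBump (0 : X)) {x : X}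
    (hx : closedBall x φ.rOut ⊆ O) :
    fderiv ℝ (mollify φ (O.indicator u)) x e = mollify φ (O.indicator g) x := by
  have hui : Integrable (O.indicator u) := hu.integrable_indicator hO
  have hder := φ.hasCompactSupport_normed.hasFDerivAt_convolution_left (μ := volume)
    (lsmul ℝ ℝ : ℝ →L[ℝ] ℝ →L[ℝ] ℝ) (φ.contDiff_normed (μ := volume) (n := 1)) hui.locallyIntegrable x
  rw [hder.fderiv]
  have hex : ConvolutionExistsAt (fderiv ℝ (φ.normed volume)) (O.indicator u) x
      ((lsmul ℝ ℝ : ℝ →L[ℝ] ℝ →L[ℝ] ℝ).precompL X) volume :=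
    (φ.hasCompactSupport_normed.fderiv ℝ).convolutionExists_left _
      ((φ.contDiff_normed (μ := volume) (n := 1)).continuous_fderiv one_ne_zero) hui.locallyIntegrable x
  rw [convolution_eq_swap, ContinuousLinearMap.integral_apply hex.integrable_swap, mollify_eq]
  -- The reflected kernel is itself an admissible test function, being supported in the ball around
  -- `x`; the reflection supplies the sign.
  set ψ : X → ℝ := fun t => φ.normed volume (x - t) with hψ
  have hψd : ContDiff ℝ ∞ ψ := φ.contDiff_normed.comp (contDiff_const.sub contDiff_id)
  have hψf : ∀ t, fderiv ℝ ψ t e = -(fderiv ℝ (φ.normed volume) (x - t) e) := fun t => by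
    have h1 : HasFDerivAt ψ ((fderiv ℝ (φ.normed volume) (x - t)).comp (-.id ℝ X)) t :=
      ((φ.contDiff_normed (μ := volume) (n := 1)).differentiable one_ne_zero (x - t)).hasFDerivAt.comp t
        ((hasFDerivAt_id t).const_sub x)
    rw [h1.fderiv]; simp
  have hψsupp : Function.support ψ ⊆ closedBall x φ.rOut := fun t ht => by
    have : x - t ∈ Function.support (φ.normed volume) := ht
    rw [φ.support_normed_eq, mem_ball_zero_iff] at this
    rw [mem_closedBall, dist_comm, dist_eq_norm]
    exact this.le
  have hψt : tsupport ψ ⊆ closedBall x φ.rOut := closure_minimal hψsupp isClosed_closedBall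
  have := h ψ hψd (HasCompactSupport.of_support_subset_isCompact (isCompact_closedBall _ _) hψsupp)
    (hψt.trans hx)
  rw [← integral_indicator hO, ← integral_indicator hO] at this
  have e1 : ∀ t, O.indicator (fun t => u t * fderiv ℝ ψ t e) t =
      -(fderiv ℝ (φ.normed volume) (x - t) e * O.indicator u t) := fun t => by
    by_cases ht : t ∈ O
    · simp only [Set.indicator_of_mem ht, hψf]; ring
    · simp [Set.indicator_of_notMem ht]
  have e2 : ∀ t, O.indicator (fun t => g t * ψ t) t = ψ t * O.indicator g t := fun t => by
    by_cases ht : t ∈ O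
    · simp only [Set.indicator_of_mem ht]; ring
    · simp [Set.indicator_of_notMem ht]
  simp only [e1, e2, integral_neg, neg_inj] at this
  rw [← this]
  rfl

theorem tendsto_integral_of_tendsto_integral_norm_sub {α : Type*} [MeasurableSpace α]
    {ν : Measure α} {F : ℕ → α → ℝ} {f : α → ℝ} (hF : ∀ n, Integrable (F n) ν)
    (hf : Integrable f ν) (h : Tendsto (fun n => ∫ x, ‖F n x - f x‖ ∂ν) atTop (𝓝 0)) :
    Tendsto (fun n => ∫ x, F n x ∂ν) atTop (𝓝 (∫ x, f x ∂ν)) := by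
  rw [tendsto_iff_norm_sub_tendsto_zero]
  refine squeeze_zero (fun n => norm_nonneg _) (fun n => ?_) h
  rw [← integral_sub (hF n) hf]
  exact norm_integral_le_integral_norm _

/-- The chain rule for weak derivatives. -/
theorem HasWeakDeriv.comp {O : Set X} (hO : IsOpen O) {e : X} {u g : X → ℝ}
    (h : HasWeakDeriv O e u g) (hu : IntegrableOn u O) (hg : IntegrableOn g O) {F : ℝ → ℝ}
    (hF : ContDiff ℝ 1 F) {M : ℝ} (hM : ∀ t, |deriv F t| ≤ M) :
    HasWeakDeriv O e (fun x => F (u x)) (fun x => deriv F (u x) * g x) := by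
  intro φ hφ hc hs
  set K := tsupport φ with hKdef
  have hK : IsCompact K := hc
  have hM0 : 0 ≤ M := (abs_nonneg _).trans (hM 0)
  have hLip : ∀ s t, |F s - F t| ≤ M * |s - t| := fun s t =>
    Convex.norm_image_sub_le_of_norm_deriv_le (fun x _ => hF.differentiable one_ne_zero x)
      (fun x _ => hM x) convex_univ (Set.mem_univ t) (Set.mem_univ s)
  have hF' : Continuous (deriv F) := hF.continuous_deriv le_rfl
  -- The ratio of outer to inner radius stays bounded, as the a.e. convergence of mollifications
  -- below demands.
  let ψ : ℕ → ContDiffBump (0 : X) := fun n =>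
    ⟨1 / ((n : ℝ) + 1), 2 * (1 / ((n : ℝ) + 1)), by positivity,
      by linarith [show (0 : ℝ) < 1 / ((n : ℝ) + 1) by positivity]⟩
  have hψ : Tendsto (fun n => (ψ n).rOut) atTop (𝓝 0) := by
    have := (tendsto_one_div_add_atTop_nhds_zero_nat (𝕜 := ℝ)).const_mul 2
    rwa [mul_zero] at this
  set v := O.indicator u with hv
  set w := O.indicator g with hw
  have hvi : Integrable v := hu.integrable_indicator hO.measurableSet
  have hwi : Integrable w := hg.integrable_indicator hO.measurableSet
  have hUc : ∀ n, Continuous (mollify (ψ n) v) := fun n => (contDiff_mollify _ hvi).continuous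
  have hDc : ∀ n, Continuous (mollify (ψ n) w) := fun n => (contDiff_mollify _ hwi).continuous
  have hφc : Continuous φ := hφ.continuous
  have hφ'c : Continuous fun x => fderiv ℝ φ x e :=
    (hφ.continuous_fderiv (by simp)).clm_apply continuous_const
  have hφ'K : HasCompactSupport fun x => fderiv ℝ φ x e := hc.fderiv_apply ℝ e
  obtain ⟨C, hC⟩ := hc.exists_bound_of_continuous hφc
  obtain ⟨C', hC'⟩ := hφ'K.exists_bound_of_continuous hφ'c
  have hC0 : 0 ≤ C := (norm_nonneg _).trans (hC 0)
  have hC'0 : 0 ≤ C' := (norm_nonneg _).trans (hC' 0)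
  -- integration by parts for the mollifications
  obtain ⟨δ, hδ, hδO⟩ := hK.exists_cthickening_subset_open hO hs
  have hparts : ∀ᶠ n in atTop, ∫ x in K, F (mollify (ψ n) v x) * fderiv ℝ φ x e =
      -∫ x in K, deriv F (mollify (ψ n) v x) * mollify (ψ n) w x * φ x := by
    filter_upwards [hψ.eventually (gt_mem_nhds hδ)] with n hn
    have hUd : ContDiff ℝ 1 (mollify (ψ n) v) := contDiff_mollify _ hvi
    have hcomp : ContDiff ℝ 1 (fun x => F (mollify (ψ n) v x)) := hF.comp hUd
    have hd : ∀ x, fderiv ℝ (fun x => F (mollify (ψ n) v x)) x e =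
        deriv F (mollify (ψ n) v x) * fderiv ℝ (mollify (ψ n) v) x e := fun x => by
      have h1 := ((hF.differentiable one_ne_zero (mollify (ψ n) v x)).hasDerivAt).comp_hasFDerivAt x
        (hUd.differentiable one_ne_zero x).hasFDerivAt
      have h2 := h1.fderiv
      change fderiv ℝ (F ∘ mollify (ψ n) v) x e = _
      rw [h2]; simp
    have hd' : ∀ x ∈ K, fderiv ℝ (mollify (ψ n) v) x e = mollify (ψ n) w x := fun x hx =>
      fderiv_mollify_apply hO.measurableSet h hu (ψ n)
        ((closedBall_subset_cthickening hx _).trans ((cthickening_mono hn.le _).trans hδO))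
    have hdc : Continuous fun x => fderiv ℝ (fun x => F (mollify (ψ n) v x)) x e :=
      (hcomp.continuous_fderiv one_ne_zero).clm_apply continuous_const
    have hip := integral_mul_fderiv_eq_neg_fderiv_mul_of_integrable (μ := volume)
      (f := fun x => F (mollify (ψ n) v x)) (g := φ) (v := e)
      ((hdc.mul hφc).integrable_of_hasCompactSupport hc.mul_left)
      ((hcomp.continuous.mul hφ'c).integrable_of_hasCompactSupport hφ'K.mul_left)
      ((hcomp.continuous.mul hφc).integrable_of_hasCompactSupport hc.mul_left)
      (fun x _ => hcomp.differentiable one_ne_zero x)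
      (fun x _ => hφ.differentiable (by simp) x)
    rw [setIntegral_mul_fderiv_eq_integral le_rfl, hip, ← setIntegral_mul_eq_integral le_rfl]
    congr 1
    refine setIntegral_congr_fun hK.measurableSet fun x hx => ?_
    simp only [hd, hd' x hx]
  have hFv : AEStronglyMeasurable (fun x => F (v x)) (volume.restrict K) :=
    hF.continuous.comp_aestronglyMeasurable hvi.aestronglyMeasurable.restrict
  have hF'v : AEStronglyMeasurable (fun x => deriv F (v x)) (volume.restrict K) :=
    hF'.comp_aestronglyMeasurable hvi.aestronglyMeasurable.restrict
  have hφm : AEStronglyMeasurable φ (volume.restrict K) := hφc.aestronglyMeasurable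
  have hφ'm : AEStronglyMeasurable (fun x => fderiv ℝ φ x e) (volume.restrict K) :=
    hφ'c.aestronglyMeasurable
  have hL : Tendsto (fun n => ∫ x in K, F (mollify (ψ n) v x) * fderiv ℝ φ x e) atTop
      (𝓝 (∫ x in K, F (v x) * fderiv ℝ φ x e)) := by
    have hsub : ∀ n, IntegrableOn (fun x => ‖mollify (ψ n) v x - v x‖) K := fun n =>
      ((integrable_mollify (ψ n) hvi).sub hvi).norm.integrableOn
    have hdiff : ∀ n x, ‖F (mollify (ψ n) v x) * fderiv ℝ φ x e - F (v x) * fderiv ℝ φ x e‖ ≤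
        M * C' * ‖mollify (ψ n) v x - v x‖ := fun n x => by
      rw [← sub_mul, norm_mul]
      calc _ ≤ (M * |mollify (ψ n) v x - v x|) * C' :=
            mul_le_mul (hLip _ _) (hC' x) (norm_nonneg _) (by positivity)
        _ = _ := by rw [Real.norm_eq_abs]; ring
    have hFn : ∀ n, IntegrableOn (fun x => F (mollify (ψ n) v x) * fderiv ℝ φ x e) K := fun n =>
      (((hF.continuous.comp (hUc n)).mul hφ'c).integrable_of_hasCompactSupport
        hφ'K.mul_left).integrableOn
    have hdi : ∀ n, IntegrableOn (fun x => F (mollify (ψ n) v x) * fderiv ℝ φ x e -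
        F (v x) * fderiv ℝ φ x e) K := fun n =>
      ((hsub n).const_mul (M * C')).mono' ((hFn n).aestronglyMeasurable.sub (hFv.mul hφ'm))
        (Eventually.of_forall (hdiff n))
    refine tendsto_integral_of_tendsto_integral_norm_sub hFn ?_ ?_
    -- Integrability of the limit is read off from one approximant minus its error.
    · refine ((hFn 0).sub (hdi 0)).congr (Eventually.of_forall fun x => ?_)
      simp
    · have h0 := (tendsto_setIntegral_mollify_sub hψ hvi hK).const_mul (M * C')
      rw [mul_zero] at h0
      refine squeeze_zero (fun n => integral_nonneg fun x => norm_nonneg _) (fun n => ?_) h0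
      rw [← integral_const_mul]
      exact integral_mono (hdi n).norm ((hsub n).const_mul _) (hdiff n)
  have hR : Tendsto (fun n => ∫ x in K, deriv F (mollify (ψ n) v x) * mollify (ψ n) w x * φ x) atTop
      (𝓝 (∫ x in K, deriv F (v x) * w x * φ x)) := by
    have hsub : ∀ n, IntegrableOn (fun x => ‖mollify (ψ n) w x - w x‖) K := fun n =>
      ((integrable_mollify (ψ n) hwi).sub hwi).norm.integrableOn
    have hFn : ∀ n, IntegrableOn
        (fun x => deriv F (mollify (ψ n) v x) * mollify (ψ n) w x * φ x) K := fun n =>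
      ((((hF'.comp (hUc n)).mul (hDc n)).mul hφc).integrable_of_hasCompactSupport
        hc.mul_left).integrableOn
    have hwn : IntegrableOn (fun x => M * C * ‖w x‖) K := (hwi.norm.const_mul _).integrableOn
    have hbd : ∀ s x, ‖deriv F s * w x * φ x‖ ≤ M * C * ‖w x‖ := fun s x => by
      rw [norm_mul, norm_mul]
      calc _ ≤ M * ‖w x‖ * C := mul_le_mul (mul_le_mul_of_nonneg_right (hM _) (norm_nonneg _))
            (hC x) (norm_nonneg _) (by positivity)
        _ = _ := by ring
    have hwm : AEStronglyMeasurable w (volume.restrict K) := hwi.aestronglyMeasurable.restrict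
    have hf : IntegrableOn (fun x => deriv F (v x) * w x * φ x) K :=
      hwn.mono' ((hF'v.mul hwm).mul hφm) (Eventually.of_forall fun x => hbd _ x)
    have hgn : ∀ n, IntegrableOn (fun x => deriv F (mollify (ψ n) v x) * w x * φ x) K := fun n =>
      hwn.mono' ((((hF'.comp (hUc n)).aestronglyMeasurable).mul hwm).mul hφm)
        (Eventually.of_forall fun x => hbd _ x)
    -- The two factors are treated apart: `w` is approximated in `L¹` against the bounded `deriv F`.
    -- After that `deriv F`, which is merely continuous, is handled by a.e. and dominated
    -- convergence.
    have h1 : Tendsto (fun n => ∫ x in K, (deriv F (mollify (ψ n) v x) * mollify (ψ n) w x * φ x -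
        deriv F (mollify (ψ n) v x) * w x * φ x)) atTop (𝓝 0) := by
      have h0 := (tendsto_setIntegral_mollify_sub hψ hwi hK).const_mul (M * C)
      rw [mul_zero] at h0
      refine squeeze_zero_norm (fun n => ?_) h0
      refine (norm_integral_le_integral_norm _).trans ?_
      rw [← integral_const_mul]
      refine integral_mono ((hFn n).sub (hgn n)).norm ((hsub n).const_mul _) fun x => ?_
      simp only
      rw [← sub_mul, ← mul_sub, norm_mul, norm_mul]
      calc _ ≤ M * ‖mollify (ψ n) w x - w x‖ * C :=
            mul_le_mul (mul_le_mul_of_nonneg_right (hM _) (norm_nonneg _))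
              (hC x) (norm_nonneg _) (by positivity)
        _ = _ := by ring
    have h2 : Tendsto (fun n => ∫ x in K, deriv F (mollify (ψ n) v x) * w x * φ x) atTop
        (𝓝 (∫ x in K, deriv F (v x) * w x * φ x)) := by
      refine tendsto_integral_of_dominated_convergence (fun x => M * C * ‖w x‖)
        (fun n => (hgn n).aestronglyMeasurable) hwn
        (fun n => Eventually.of_forall fun x => hbd _ x) ?_
      have hae := ContDiffBump.ae_convolution_tendsto_right_of_locallyIntegrable (μ := volume)
        (φ := ψ) (K := 2) hψ (Eventually.of_forall fun n => le_rfl) hvi.locallyIntegrable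
      filter_upwards [ae_restrict_of_ae hae] with x hx
      exact (((hF'.tendsto _).comp hx).mul_const _).mul_const _
    have h3 := h1.add h2
    rw [zero_add] at h3
    refine h3.congr fun n => ?_
    rw [integral_sub (hFn n) (hgn n)]
    ring
  have hlim := tendsto_nhds_unique (hL.congr' hparts) hR.neg
  rw [setIntegral_mul_fderiv_eq_integral hs, setIntegral_mul_eq_integral hs,
    ← setIntegral_mul_fderiv_eq_integral (le_refl K), ← setIntegral_mul_eq_integral (le_refl K)]
  have ev : ∀ x ∈ K, v x = u x := fun x hx => Set.indicator_of_mem (hs hx) u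
  have ew : ∀ x ∈ K, w x = g x := fun x hx => Set.indicator_of_mem (hs hx) g
  rw [setIntegral_congr_fun (f := fun x => F (v x) * fderiv ℝ φ x e)
      (g := fun x => F (u x) * fderiv ℝ φ x e) hK.measurableSet
      fun x hx => by simp only [ev x hx],
    setIntegral_congr_fun (f := fun x => deriv F (v x) * w x * φ x)
      (g := fun x => deriv F (u x) * g x * φ x) hK.measurableSet
      fun x hx => by simp only [ev x hx, ew x hx]] at hlim
  exact hlim

end Mollification

variable {N : ℕ} {Ω : Set (E N)}

/-! ### Sobolev spaces as closed subspaces of pairs (function, gradient). -/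

section Sobolev

/-- Pairs of a function in `L²(Ω)` and a vector field in `L²(Ω; ℝ^N)`, as a Hilbert space. -/
abbrev GradSpace (Ω : Set (E N)) : Type := WithLp 2 (L2 Ω × L2Vec Ω)

theorem inner_L2_eq {α : Type*} [MeasurableSpace α] {ν : Measure α} (u v : Lp ℝ 2 ν) :
    inner ℝ u v = ∫ x, u x * v x ∂ν := by
  rw [L2.inner_def]
  refine integral_congr_ae (Eventually.of_forall fun x => ?_)
  simp [mul_comm]

/-- Expresses both sides of the integration by parts as inner products, so that the weak gradient
relation becomes a family of continuous linear equations. -/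
theorem exists_testFunction_pairing {φ : E N → ℝ} (hφ : ContDiff ℝ ∞ φ) (hc : HasCompactSupport φ)
    (i : Fin N) : ∃ (a : L2 Ω) (b : L2Vec Ω), ∀ (u : L2 Ω) (G : L2Vec Ω),
      ∫ x in Ω, u x * fderiv ℝ φ x (EuclideanSpace.single i 1) = inner ℝ u a ∧
        ∫ x in Ω, G x i * φ x = inner ℝ G b := by
  have ha : MemLp (fun x => fderiv ℝ φ x (EuclideanSpace.single i 1)) 2
      ((volume : Measure (E N)).restrict Ω) :=
    (((hφ.continuous_fderiv (by simp)).clm_apply continuous_const).memLp_of_hasCompactSupport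
      (hc.fderiv_apply ℝ _)).restrict Ω
  have hb : MemLp (fun x => φ x • (EuclideanSpace.single i 1 : E N)) 2
      ((volume : Measure (E N)).restrict Ω) :=
    ((hφ.continuous.smul continuous_const).memLp_of_hasCompactSupport hc.smul_right).restrict Ω
  refine ⟨ha.toLp, hb.toLp, fun u G => ⟨?_, ?_⟩⟩
  · rw [inner_L2_eq]
    refine integral_congr_ae ?_
    filter_upwards [ha.coeFn_toLp] with x hx
    rw [hx]
  · rw [L2.inner_def]
    refine integral_congr_ae ?_
    filter_upwards [hb.coeFn_toLp] with x hx
    rw [hx, real_inner_smul_right, EuclideanSpace.inner_single_right]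
    simp [mul_comm]

/-- The graph of the weak gradient. -/
def gradGraph (Ω : Set (E N)) : Submodule ℝ (GradSpace Ω) where
  carrier := {p | IsWeakGradient Ω p.fst p.snd}
  zero_mem' := by
    intro φ hφ hc _ i
    obtain ⟨a, b, h⟩ := exists_testFunction_pairing (Ω := Ω) hφ hc i
    rw [(h _ 0).1, (h 0 _).2]
    simp
  add_mem' := by
    intro p q hp hq φ hφ hc hs i
    obtain ⟨a, b, h⟩ := exists_testFunction_pairing (Ω := Ω) hφ hc i
    have h1 := hp φ hφ hc hs i
    have h2 := hq φ hφ hc hs i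
    rw [(h _ 0).1, (h 0 _).2] at h1 h2 ⊢
    rw [WithLp.add_fst, WithLp.add_snd, inner_add_left, inner_add_left, h1, h2]
    ring
  smul_mem' := by
    intro r p hp φ hφ hc hs i
    obtain ⟨a, b, h⟩ := exists_testFunction_pairing (Ω := Ω) hφ hc i
    have h1 := hp φ hφ hc hs i
    rw [(h _ 0).1, (h 0 _).2] at h1 ⊢
    rw [WithLp.smul_fst, WithLp.smul_snd, real_inner_smul_left, real_inner_smul_left, h1]
    ring

theorem isClosed_gradGraph : IsClosed (gradGraph Ω : Set (GradSpace Ω)) := by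
  have : (gradGraph Ω : Set (GradSpace Ω)) = {p | IsWeakGradient Ω p.fst p.snd} := rfl
  rw [this]
  simp only [IsWeakGradient, Set.ofPred_forall]
  refine isClosed_iInter fun φ => isClosed_iInter fun hφ => isClosed_iInter fun hc =>
    isClosed_iInter fun _ => isClosed_iInter fun i => ?_
  obtain ⟨a, b, h⟩ := exists_testFunction_pairing (Ω := Ω) hφ hc i
  have h1 : ∀ p : GradSpace Ω, ∫ x in Ω, p.fst x * fderiv ℝ φ x (EuclideanSpace.single i 1) =
    inner ℝ p.fst a := fun p => (h _ 0).1
  have h2 : ∀ p : GradSpace Ω, ∫ x in Ω, p.snd x i * φ x = inner ℝ p.snd b := fun p => (h 0 _).2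
  simp only [h1, h2]
  exact isClosed_eq (by fun_prop) (by fun_prop)

/-- By linearity `G - G'` is a weak gradient of `0`, so each coordinate annihilates every test
function on `Ω`. -/
theorem IsWeakGradient.eq (hΩ : IsOpen Ω) {u : L2 Ω} {G G' : L2Vec Ω}
    (h : IsWeakGradient Ω u G) (h' : IsWeakGradient Ω u G') : G = G' := by
  have hmem : (WithLp.toLp 2 (0, G - G') : GradSpace Ω) ∈ gradGraph Ω := by
    have h1 : (WithLp.toLp 2 (u, G) : GradSpace Ω) ∈ gradGraph Ω := h
    have h2 : (WithLp.toLp 2 (u, G') : GradSpace Ω) ∈ gradGraph Ω := h'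
    have := (gradGraph Ω).sub_mem h1 h2
    rwa [← WithLp.toLp_sub, Prod.mk_sub_mk, sub_self] at this
  have hcoord : ∀ i, ∀ᵐ x, x ∈ Ω → (G - G') x i = 0 := fun i => by
    have hloc : LocallyIntegrableOn (fun x => (G - G') x i) Ω volume := by
      refine locallyIntegrableOn_of_locallyIntegrable_restrict ?_
      have hm : MemLp (fun x => (G - G') x i) 2 ((volume : Measure (E N)).restrict Ω) :=
        (EuclideanSpace.proj (𝕜 := ℝ) i).comp_memLp' (Lp.memLp (G - G'))
      exact hm.locallyIntegrable (by norm_num)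
    refine hΩ.ae_eq_zero_of_integral_contDiff_smul_eq_zero hloc fun φ hφ hc hs => ?_
    obtain ⟨a, b, h⟩ := exists_testFunction_pairing (Ω := Ω) hφ hc i
    have h1 : inner ℝ (0 : L2 Ω) a = -∫ x in Ω, (G - G') x i * φ x :=
      (h 0 0).1.symm.trans (hmem φ hφ hc hs i)
    rw [inner_zero_left, setIntegral_mul_eq_integral hs] at h1
    simp only [smul_eq_mul, mul_comm (φ _)]
    linarith
  rw [← sub_eq_zero]
  refine Lp.ext ?_
  filter_upwards [ae_all_iff.2 fun i => (ae_restrict_iff' hΩ.measurableSet).2 (hcoord i),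
    Lp.coeFn_zero (E N) 2 ((volume : Measure (E N)).restrict Ω)] with x hx h0
  rw [h0]
  ext i
  exact hx i

theorem weakGrad_eq (hΩ : IsOpen Ω) {p : GradSpace Ω} (hp : p ∈ gradGraph Ω) :
    weakGrad Ω p.fst = p.snd := by
  have hex : ∃ G : L2Vec Ω, IsWeakGradient Ω p.fst G := ⟨_, hp⟩
  rw [weakGrad, dif_pos hex]
  exact hex.choose_spec.eq hΩ hp

theorem dirichletForm_eq (hΩ : IsOpen Ω) {p q : GradSpace Ω} (hp : p ∈ gradGraph Ω)
    (hq : q ∈ gradGraph Ω) : dirichletForm Ω p.fst q.fst = inner ℝ p.snd q.snd := by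
  rw [dirichletForm, weakGrad_eq hΩ hp, weakGrad_eq hΩ hq, L2.inner_def]

theorem energyOne_eq (hΩ : IsOpen Ω) {p q : GradSpace Ω} (hp : p ∈ gradGraph Ω)
    (hq : q ∈ gradGraph Ω) : energyOne Ω p.fst q.fst = inner ℝ p q := by
  rw [energyOne, dirichletForm_eq hΩ hp hq, ← inner_L2_eq, WithLp.prod_inner_apply, add_comm]
  rfl

theorem energyOne_self (hΩ : IsOpen Ω) {p : GradSpace Ω} (hp : p ∈ gradGraph Ω) :
    energyOne Ω p.fst p.fst = ‖p‖ ^ 2 := by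
  rw [energyOne_eq hΩ hp hp, real_inner_self_eq_norm_sq]

theorem norm_le_of_norm_fst_le_of_norm_snd_le {p q : GradSpace Ω} (h1 : ‖p.fst‖ ≤ ‖q.fst‖)
    (h2 : ‖p.snd‖ ≤ ‖q.snd‖) : ‖p‖ ≤ ‖q‖ := by
  rw [WithLp.prod_norm_eq_of_L2, WithLp.prod_norm_eq_of_L2]
  gcongr

/-- A function of a Sobolev function, for a smooth contraction that fixes the origin. -/
theorem exists_comp_mem_gradGraph (hΩ : IsOpen Ω) {p : GradSpace Ω} (hp : p ∈ gradGraph Ω)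
    {F : ℝ → ℝ} (hF : ContDiff ℝ 1 F) (hF' : ∀ t, |deriv F t| ≤ 1) (hF0 : ∀ t, |F t| ≤ |t|) :
    ∃ q ∈ gradGraph Ω, (∀ᵐ x ∂((volume : Measure (E N)).restrict Ω), q.fst x = F (p.fst x)) ∧
      ‖q‖ ≤ ‖p‖ := by
  have hu : MemLp (fun x => F (p.fst x)) 2 ((volume : Measure (E N)).restrict Ω) :=
    (Lp.memLp p.fst).of_le (hF.continuous.comp_aestronglyMeasurable
      (Lp.aestronglyMeasurable p.fst)) (Eventually.of_forall fun x => hF0 _)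
  have hGle : ∀ x, ‖deriv F (p.fst x) • p.snd x‖ ≤ ‖p.snd x‖ := fun x => by
    rw [norm_smul]
    exact mul_le_of_le_one_left (norm_nonneg _) (hF' _)
  have hG : MemLp (fun x => deriv F (p.fst x) • p.snd x) 2
      ((volume : Measure (E N)).restrict Ω) :=
    (Lp.memLp p.snd).of_le (((hF.continuous_deriv le_rfl).comp_aestronglyMeasurable
      (Lp.aestronglyMeasurable p.fst)).smul (Lp.aestronglyMeasurable p.snd))
      (Eventually.of_forall hGle)
  refine ⟨WithLp.toLp 2 (hu.toLp, hG.toLp), ?_, hu.coeFn_toLp, ?_⟩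
  · intro φ hφ hc hs i
    obtain ⟨R, hR⟩ := hc.isBounded.subset_ball 0
    -- The chain rule needs integrability; on a bounded piece containing the support, `L²` embeds in
    -- `L¹`.
    set O : Set (E N) := Ω ∩ Metric.ball 0 R with hO
    have hOo : IsOpen O := hΩ.inter Metric.isOpen_ball
    have hOf : volume O ≠ ⊤ :=
      ((measure_mono Set.inter_subset_right).trans_lt measure_ball_lt_top).ne
    have hint : ∀ {f : E N → ℝ}, MemLp f 2 ((volume : Measure (E N)).restrict Ω) →
        IntegrableOn f O := fun hf => by
      have : IsFiniteMeasure ((volume : Measure (E N)).restrict O) := ⟨by simpa using hOf.lt_top⟩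
      exact (hf.mono_measure (Measure.restrict_mono Set.inter_subset_left le_rfl)).integrable
        (by norm_num)
    have hwd : HasWeakDeriv Ω (EuclideanSpace.single i 1) p.fst (fun x => p.snd x i) :=
      fun φ hφ hc hs => hp φ hφ hc hs i
    have hch := (hwd.mono Set.inter_subset_left).comp hOo (hint (Lp.memLp p.fst))
      (hint ((EuclideanSpace.proj (𝕜 := ℝ) i).comp_memLp' (Lp.memLp p.snd))) hF hF'
    have hsO : tsupport φ ⊆ O := Set.subset_inter hs hR
    have := hch φ hφ hc hsO
    rw [setIntegral_mul_fderiv_eq_integral hsO, setIntegral_mul_eq_integral hsO,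
      ← setIntegral_mul_fderiv_eq_integral hs, ← setIntegral_mul_eq_integral hs] at this
    convert this using 1
    · refine integral_congr_ae ?_
      filter_upwards [hu.coeFn_toLp] with x hx
      exact congrArg (fun t => t * fderiv ℝ φ x (EuclideanSpace.single i 1)) hx
    · congr 1
      refine integral_congr_ae ?_
      filter_upwards [hG.coeFn_toLp] with x hx
      exact (congrArg (fun v : E N => v i * φ x) hx).trans (by simp)
  · refine norm_le_of_norm_fst_le_of_norm_snd_le ?_ ?_
    · refine Lp.norm_le_norm_of_ae_le ?_
      filter_upwards [hu.coeFn_toLp] with x hx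
      exact (congrArg norm hx).trans_le (hF0 _)
    · refine Lp.norm_le_norm_of_ae_le ?_
      filter_upwards [hG.coeFn_toLp] with x hx
      exact (congrArg norm hx).trans_le (hGle x)

/-- Dominated convergence in `L²`. -/
theorem tendsto_L2_of_dominated {α : Type*} [MeasurableSpace α] {ν : Measure α}
    {f : ℕ → Lp ℝ 2 ν} {g b : Lp ℝ 2 ν} (hb : ∀ n, ∀ᵐ x ∂ν, |f n x - g x| ≤ |b x|)
    (hlim : ∀ᵐ x ∂ν, Tendsto (fun n => f n x) atTop (𝓝 (g x))) : Tendsto f atTop (𝓝 g) := by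
  rw [tendsto_iff_norm_sub_tendsto_zero]
  have hsq : ∀ h : Lp ℝ 2 ν, ‖h‖ ^ 2 = ∫ x, h x ^ 2 ∂ν := fun h => by
    rw [← real_inner_self_eq_norm_sq, L2.inner_def]
    exact integral_congr_ae (Eventually.of_forall fun x => by simp [sq])
  have h1 : Tendsto (fun n => ∫ x, (f n - g : Lp ℝ 2 ν) x ^ 2 ∂ν) atTop (𝓝 (∫ _, (0 : ℝ) ∂ν)) := by
    refine tendsto_integral_of_dominated_convergence (fun x => b x ^ 2)
      (fun n => (Lp.aestronglyMeasurable _).pow 2) (Lp.memLp b).integrable_sq (fun n => ?_) ?_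
    · filter_upwards [hb n, Lp.coeFn_sub (f n) g] with x hx hs
      rw [hs, Pi.sub_apply, norm_pow, Real.norm_eq_abs, ← sq_abs (b x)]
      gcongr
    · filter_upwards [hlim, ae_all_iff.2 fun n => Lp.coeFn_sub (f n) g] with x hx hs
      simp only [hs, Pi.sub_apply]
      have := (hx.sub_const (g x)).pow 2
      simpa using this
  simp only [← hsq, integral_zero] at h1
  have h2 := h1.sqrt
  simpa [Real.sqrt_sq (norm_nonneg _)] using h2

/-- `√(t² + ε²) - ε` is the smooth substitute for `|t|`. Subtracting `ε` makes it vanish at `0`,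
which keeps compositions in `L²` even if `Ω` has infinite measure. -/
theorem contDiff_sqrt_sq_add {ε : ℝ} (hε : 0 < ε) :
    ContDiff ℝ 1 fun t : ℝ => √(t ^ 2 + ε ^ 2) - ε :=
  ((((contDiff_id.pow 2).add contDiff_const)).sqrt fun t => by positivity).sub contDiff_const

theorem abs_deriv_sqrt_sq_add_le {ε : ℝ} (hε : 0 < ε) (t : ℝ) :
    |deriv (fun t : ℝ => √(t ^ 2 + ε ^ 2) - ε) t| ≤ 1 := by
  have h0 : 0 < √(t ^ 2 + ε ^ 2) := Real.sqrt_pos.2 (by positivity)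
  have h : HasDerivAt (fun t : ℝ => √(t ^ 2 + ε ^ 2) - ε) (t / √(t ^ 2 + ε ^ 2)) t := by
    have h1 : HasDerivAt (fun t : ℝ => t ^ 2 + ε ^ 2) (2 * t) t := by
      simpa using (hasDerivAt_pow 2 t).add_const (ε ^ 2)
    exact ((h1.sqrt (by positivity)).sub_const ε).congr_deriv (mul_div_mul_left _ _ two_ne_zero)
  rw [h.deriv, abs_div, abs_of_pos h0, div_le_one h0]
  exact Real.abs_le_sqrt (by nlinarith [sq_nonneg ε])

theorem sqrt_sq_add_sub_nonneg (ε t : ℝ) : 0 ≤ √(t ^ 2 + ε ^ 2) - ε :=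
  sub_nonneg.2 (Real.le_sqrt_of_sq_le (by nlinarith [sq_nonneg t]))

theorem sqrt_sq_add_sub_le {ε : ℝ} (hε : 0 < ε) (t : ℝ) : √(t ^ 2 + ε ^ 2) - ε ≤ |t| := by
  rw [sub_le_iff_le_add, Real.sqrt_le_left (by positivity), ← sq_abs t]
  nlinarith [abs_nonneg t]

/-- The absolute value of a Sobolev function is a Sobolev function of no larger norm. -/
theorem exists_abs_mem_gradGraph (hΩ : IsOpen Ω) {p : GradSpace Ω} (hp : p ∈ gradGraph Ω) :
    ∃ q ∈ gradGraph Ω, q.fst = |p.fst| ∧ ‖q‖ ≤ ‖p‖ := by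
  have : CompleteSpace (gradGraph Ω) := isClosed_gradGraph.completeSpace_coe
  have hε : ∀ n : ℕ, (0 : ℝ) < 1 / ((n : ℝ) + 1) := fun n => by positivity
  choose q hq hqF hqn using fun n : ℕ => exists_comp_mem_gradGraph hΩ hp
    (contDiff_sqrt_sq_add (hε n)) (abs_deriv_sqrt_sq_add_le (hε n)) (fun t => by
      rw [abs_of_nonneg (sqrt_sq_add_sub_nonneg _ t)]; exact sqrt_sq_add_sub_le (hε n) t)
  have hlim : Tendsto (fun n => (q n).fst) atTop (𝓝 |p.fst|) := by
    refine tendsto_L2_of_dominated (b := p.fst) (fun n => ?_) ?_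
    · filter_upwards [hqF n, Lp.coeFn_abs p.fst] with x hx ha
      rw [hx, ha, abs_sub_comm, abs_le]
      have h1 := sqrt_sq_add_sub_nonneg (1 / ((n : ℝ) + 1)) (p.fst x)
      have h2 := sqrt_sq_add_sub_le (hε n) (p.fst x)
      constructor <;> linarith [abs_nonneg (p.fst x)]
    · filter_upwards [ae_all_iff.2 hqF, Lp.coeFn_abs p.fst] with x hx ha
      simp only [hx, ha]
      have h0 := tendsto_one_div_add_atTop_nhds_zero_nat (𝕜 := ℝ)
      have h1 := ((tendsto_const_nhds (x := p.fst x ^ 2)).add (h0.pow 2)).sqrt.sub h0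
      simpa [Real.sqrt_sq_eq_abs] using h1
  -- The gradients are only bounded, but a weak limit stays in the closed graph; no formula for
  -- `∇|u|` is needed.
  obtain ⟨w, hw, hw'⟩ := exists_eq_of_bounded_of_tendsto
    ((WithLp.fstL 2 ℝ (L2 Ω) (L2Vec Ω)).comp (gradGraph Ω).subtypeL)
    (v := fun n => ⟨q n, hq n⟩) hqn hlim
  exact ⟨w, w.2, hw', hw⟩

/-- The Sobolev functions with a representative in `C_c(closure Ω)`. -/
def ccGraph (Ω : Set (E N)) : Submodule ℝ (GradSpace Ω) where
  carrier := {p | p ∈ gradGraph Ω ∧ HasCcRepresentative Ω p.fst}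
  zero_mem' := ⟨zero_mem _, 0, continuousOn_const, ⟨∅, isCompact_empty, Set.empty_subset _,
    fun _ _ => rfl⟩, Lp.coeFn_zero ℝ 2 _⟩
  add_mem' := by
    rintro p q ⟨hp, g, hg, ⟨K, hK, hKΩ, hgK⟩, hgp⟩ ⟨hq, f, hf, ⟨L, hL, hLΩ, hfL⟩, hfq⟩
    refine ⟨add_mem hp hq, g + f, hg.add hf, ⟨K ∪ L, hK.union hL, Set.union_subset hKΩ hLΩ,
      fun x hx => ?_⟩, ?_⟩
    · rw [Pi.add_apply, hgK x ⟨hx.1, fun h => hx.2 (Or.inl h)⟩,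
        hfL x ⟨hx.1, fun h => hx.2 (Or.inr h)⟩, add_zero]
    · filter_upwards [hgp, hfq, Lp.coeFn_add p.fst q.fst] with x h1 h2 h3
      rw [WithLp.add_fst, h3, Pi.add_apply, Pi.add_apply, h1, h2]
  smul_mem' := by
    rintro r p ⟨hp, g, hg, ⟨K, hK, hKΩ, hgK⟩, hgp⟩
    refine ⟨Submodule.smul_mem _ r hp, r • g, hg.const_smul r, ⟨K, hK, hKΩ, fun x hx => ?_⟩, ?_⟩
    · rw [Pi.smul_apply, hgK x hx, smul_zero]
    · filter_upwards [hgp, Lp.coeFn_smul r p.fst] with x h1 h2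
      rw [WithLp.smul_fst, h2, Pi.smul_apply, Pi.smul_apply, h1]

/-- The space `H̃¹(Ω)` of the functions together with their gradients. -/
def tildeGraph (Ω : Set (E N)) : Submodule ℝ (GradSpace Ω) := (ccGraph Ω).topologicalClosure

theorem ccGraph_le_gradGraph : ccGraph Ω ≤ gradGraph Ω := fun _ h => h.1

theorem ccGraph_le_tildeGraph : ccGraph Ω ≤ tildeGraph Ω := Submodule.le_topologicalClosure _

theorem tildeGraph_le_gradGraph : tildeGraph Ω ≤ gradGraph Ω :=
  Submodule.topologicalClosure_minimal _ ccGraph_le_gradGraph isClosed_gradGraph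

instance : CompleteSpace (tildeGraph Ω) :=
  (Submodule.isClosed_topologicalClosure (ccGraph Ω)).completeSpace_coe

theorem mem_tildeH1_iff (hΩ : IsOpen Ω) {u : L2 Ω} :
    u ∈ tildeH1 Ω ↔ ∃ p ∈ tildeGraph Ω, p.fst = u := by
  constructor
  · rintro ⟨⟨G, hG⟩, hu⟩
    set p : GradSpace Ω := WithLp.toLp 2 (u, G) with hp
    have hpm : p ∈ gradGraph Ω := hG
    refine ⟨p, ?_, rfl⟩
    change p ∈ closure (ccGraph Ω : Set (GradSpace Ω))
    rw [Metric.mem_closure_iff]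
    intro ε hε
    obtain ⟨w, ⟨Gw, hGw⟩, hw, hlt⟩ := hu (ε ^ 2) (by positivity)
    set q : GradSpace Ω := WithLp.toLp 2 (w, Gw) with hq
    have hqm : q ∈ gradGraph Ω := hGw
    refine ⟨q, ⟨hqm, hw⟩, ?_⟩
    have h1 : energyOne Ω (p - q).fst (p - q).fst < ε ^ 2 := hlt
    rw [energyOne_self hΩ (sub_mem hpm hqm)] at h1
    rw [dist_eq_norm]
    exact lt_of_pow_lt_pow_left₀ 2 hε.le h1
  · rintro ⟨p, hp, rfl⟩
    have hpm := tildeGraph_le_gradGraph hp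
    refine ⟨⟨p.snd, hpm⟩, fun ε hε => ?_⟩
    obtain ⟨q, hq, hlt⟩ := Metric.mem_closure_iff.1 hp (√ε) (Real.sqrt_pos.2 hε)
    refine ⟨q.fst, ⟨q.snd, hq.1⟩, hq.2, ?_⟩
    rw [dist_eq_norm, Real.lt_sqrt (norm_nonneg _)] at hlt
    rw [← WithLp.sub_fst, energyOne_self hΩ (sub_mem hpm hq.1)]
    exact hlt

theorem exists_abs_mem_ccGraph (hΩ : IsOpen Ω) {p : GradSpace Ω} (hp : p ∈ ccGraph Ω) :
    ∃ q ∈ ccGraph Ω, q.fst = |p.fst| ∧ ‖q‖ ≤ ‖p‖ := by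
  obtain ⟨hp, g, hg, ⟨K, hK, hKΩ, hgK⟩, hgp⟩ := hp
  obtain ⟨q, hq, hqp, hn⟩ := exists_abs_mem_gradGraph hΩ hp
  refine ⟨q, ⟨hq, fun x => |g x|, hg.abs, ⟨K, hK, hKΩ, fun x hx => ?_⟩, ?_⟩, hqp, hn⟩
  · simp [hgK x hx]
  · filter_upwards [hgp, Lp.coeFn_abs p.fst] with x h1 h2
    rw [hqp, h2, h1]

/-- `H̃¹(Ω)` is closed under absolute values. -/
theorem exists_abs_mem_tildeGraph (hΩ : IsOpen Ω) {p : GradSpace Ω} (hp : p ∈ tildeGraph Ω)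
    {r : ℝ} (hr : ‖p‖ < r) : ∃ q ∈ tildeGraph Ω, q.fst = |p.fst| ∧ ‖q‖ ≤ r := by
  obtain ⟨s, hs, hlim⟩ := mem_closure_iff_seq_limit.1 hp
  -- The approximants may have norm above `‖p‖`; the strict bound by `r` absorbs this.
  obtain ⟨n₀, hn₀⟩ := eventually_atTop.1 (hlim.norm.eventually (gt_mem_nhds hr))
  choose q hq hqs hqn using fun n => exists_abs_mem_ccGraph hΩ (hs (n + n₀))
  have h1 : Tendsto (fun n => (s (n + n₀)).fst) atTop (𝓝 p.fst) :=
    ((WithLp.fstL 2 ℝ (L2 Ω) (L2Vec Ω)).continuous.tendsto p).comp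
      (hlim.comp (tendsto_add_atTop_nat n₀))
  have h2 : Tendsto (fun n => (q n).fst) atTop (𝓝 |p.fst|) := by
    rw [tendsto_iff_norm_sub_tendsto_zero] at h1 ⊢
    refine squeeze_zero (fun _ => norm_nonneg _) (fun n => ?_) h1
    rw [hqs]
    exact norm_abs_sub_abs _ _
  obtain ⟨w, hw, hw'⟩ := exists_eq_of_bounded_of_tendsto
    ((WithLp.fstL 2 ℝ (L2 Ω) (L2Vec Ω)).comp (tildeGraph Ω).subtypeL)
    (v := fun n => ⟨q n, ccGraph_le_tildeGraph (hq n)⟩)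
    (fun n => (hqn n).trans (hn₀ _ (Nat.le_add_left _ _)).le) h2
  exact ⟨w, w.2, hw', hw⟩

end Sobolev

/-! ### Calculus of the square root of the capacity. -/

section Capacity

/-- The part of `A` in `closure Ω` has a relatively open neighbourhood on which some nonnegative
function of `H̃¹(Ω)` of norm at most `r` is at least `1`: the square root of the relative capacity
of `A` is at most `r`. -/
def SqrtCapLE (Ω A : Set (E N)) (r : ℝ) : Prop :=
  ∃ U : Set (E N), IsOpen U ∧ A ∩ closure Ω ⊆ U ∧ ∃ p ∈ tildeGraph Ω,
    (∀ᵐ x ∂((volume : Measure (E N)).restrict Ω), 0 ≤ p.fst x) ∧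
    (∀ᵐ x ∂((volume : Measure (E N)).restrict Ω), x ∈ U → 1 ≤ p.fst x) ∧ ‖p‖ ≤ r

theorem SqrtCapLE.mono {A B : Set (E N)} {r s : ℝ} (h : SqrtCapLE Ω B r)
    (hAB : A ∩ closure Ω ⊆ B) (hrs : r ≤ s) : SqrtCapLE Ω A s := by
  obtain ⟨U, hU, hBU, p, hp, hp0, hp1, hpr⟩ := h
  exact ⟨U, hU, fun x hx => hBU ⟨hAB hx, hx.2⟩, p, hp, hp0, hp1, hpr.trans hrs⟩

theorem SqrtCapLE.exists_isOpen {A : Set (E N)} {r : ℝ} (h : SqrtCapLE Ω A r) :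
    ∃ U, IsOpen U ∧ A ∩ closure Ω ⊆ U ∧ SqrtCapLE Ω U r := by
  obtain ⟨U, hU, hAU, hp⟩ := h
  exact ⟨U, hU, hAU, U, hU, Set.inter_subset_left, hp⟩

/-- The sum of the potentials works because each is nonnegative. Bounding the norm rather than its
square makes this the triangle inequality. -/
theorem SqrtCapLE.union {A B : Set (E N)} {r s : ℝ} (hA : SqrtCapLE Ω A r)
    (hB : SqrtCapLE Ω B s) : SqrtCapLE Ω (A ∪ B) (r + s) := by
  obtain ⟨U, hU, hAU, p, hp, hp0, hp1, hpr⟩ := hA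
  obtain ⟨V, hV, hBV, q, hq, hq0, hq1, hqr⟩ := hB
  refine ⟨U ∪ V, hU.union hV, ?_, p + q, add_mem hp hq, ?_, ?_,
    (norm_add_le _ _).trans (add_le_add hpr hqr)⟩
  · rintro x ⟨hx | hx, hxΩ⟩
    exacts [Or.inl (hAU ⟨hx, hxΩ⟩), Or.inr (hBV ⟨hx, hxΩ⟩)]
  · filter_upwards [hp0, hq0, Lp.coeFn_add p.fst q.fst] with x h1 h2 h3
    rw [WithLp.add_fst, h3, Pi.add_apply]
    exact add_nonneg h1 h2
  · filter_upwards [hp0, hq0, hp1, hq1, Lp.coeFn_add p.fst q.fst] with x h1 h2 h3 h4 h5 hx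
    rw [WithLp.add_fst, h5, Pi.add_apply]
    rcases hx with hx | hx
    · linarith [h3 hx]
    · linarith [h4 hx]

theorem sqrtCapLE_empty {r : ℝ} (hr : 0 ≤ r) : SqrtCapLE Ω ∅ r := by
  refine ⟨∅, isOpen_empty, by simp, 0, zero_mem _, ?_, by simp, by simpa⟩
  filter_upwards [Lp.coeFn_zero ℝ 2 ((volume : Measure (E N)).restrict Ω)] with x hx
  rw [WithLp.zero_fst, hx]
  simp

/-- Countable subadditivity. -/
theorem sqrtCapLE_iUnion {A : ℕ → Set (E N)} {r : ℕ → ℝ} {R : ℝ}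
    (hA : ∀ n, SqrtCapLE Ω (A n) (r n)) (hr : HasSum r R) : SqrtCapLE Ω (⋃ n, A n) R := by
  choose U hU hAU p hp hp0 hp1 hpr using hA
  have hsum : Summable p := Summable.of_norm_bounded hr.summable hpr
  -- In the order of `L²`, a sum of nonnegative terms dominates each term.
  have hle : ∀ n, (p n).fst ≤ (∑' n, p n).fst := fun n => by
    have h1 : HasSum (fun n => (p n).fst) (∑' n, p n).fst :=
      hsum.hasSum.mapL (WithLp.fstL 2 ℝ (L2 Ω) (L2Vec Ω))
    have h0 : ∀ m, 0 ≤ (p m).fst := fun m => (Lp.coeFn_nonneg _).1 (hp0 m)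
    exact le_hasSum h1 n fun m _ => h0 m
  have hle' : ∀ᵐ x ∂((volume : Measure (E N)).restrict Ω), ∀ n,
      (p n).fst x ≤ (∑' n, p n).fst x :=
    ae_all_iff.2 fun n => (Lp.coeFn_le _ _).2 (hle n)
  refine ⟨⋃ n, U n, isOpen_iUnion hU, ?_, ∑' n, p n, ?_, ?_, ?_, tsum_of_norm_bounded hr hpr⟩
  · rintro x ⟨hx, hxΩ⟩
    obtain ⟨n, hn⟩ := Set.mem_iUnion.1 hx
    exact Set.mem_iUnion.2 ⟨n, hAU n ⟨hn, hxΩ⟩⟩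
  · exact (Submodule.isClosed_topologicalClosure (ccGraph Ω)).mem_of_tendsto hsum.hasSum
      (Eventually.of_forall fun s => Submodule.sum_mem _ fun n _ => hp n)
  · filter_upwards [hp0 0, hle'] with x h1 h2
    exact h1.trans (h2 0)
  · filter_upwards [ae_all_iff.2 hp1, hle'] with x h1 h2 hx
    obtain ⟨n, hn⟩ := Set.mem_iUnion.1 hx
    exact (h1 n hn).trans (h2 n)

theorem sqrtCapLE_of_relCap_lt (hΩ : IsOpen Ω) {A : Set (E N)} {r : ℝ} (hr : 0 < r)
    (h : relCap Ω A < ENNReal.ofReal (r ^ 2)) : SqrtCapLE Ω A r := by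
  obtain ⟨⟨U, hU, hAU⟩, h⟩ := iInf_lt_iff.1 h
  obtain ⟨⟨u, hu, hu1⟩, h⟩ := iInf_lt_iff.1 h
  obtain ⟨p, hp, rfl⟩ := (mem_tildeH1_iff hΩ).1 hu
  simp only at h
  rw [energyOne_self hΩ (tildeGraph_le_gradGraph hp),
    ENNReal.ofReal_lt_ofReal_iff (by positivity)] at h
  -- A competitor for the capacity may change sign, so its absolute value serves as the potential.
  obtain ⟨q, hq, hqp, hqr⟩ := exists_abs_mem_tildeGraph hΩ hp
    (lt_of_pow_lt_pow_left₀ 2 hr.le h)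
  refine ⟨U, hU, fun x hx => (hAU hx.1).2, q, hq, ?_, ?_, hqr⟩
  · filter_upwards [Lp.coeFn_abs p.fst] with x hx
    rw [hqp, hx]
    exact abs_nonneg _
  · filter_upwards [Lp.coeFn_abs p.fst, hu1, ae_restrict_mem hΩ.measurableSet] with x hx h1 h2 h3
    rw [hqp, hx]
    exact (h1 ⟨subset_closure h2, h3⟩).trans (le_abs_self _)

theorem SqrtCapLE.relCap_le (hΩ : IsOpen Ω) {A : Set (E N)} (hA : A ⊆ closure Ω) {r : ℝ}
    (h : SqrtCapLE Ω A r) : relCap Ω A ≤ ENNReal.ofReal (r ^ 2) := by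
  obtain ⟨U, hU, hAU, p, hp, hp0, hp1, hpr⟩ := h
  refine (iInf_le _ ⟨U, hU, fun x hx => ⟨hA hx, hAU ⟨hx, hA hx⟩⟩⟩).trans ?_
  refine (iInf_le _ ⟨p.fst, (mem_tildeH1_iff hΩ).2 ⟨p, hp, rfl⟩, ?_⟩).trans ?_
  · simp only
    rw [energyOne_self hΩ (tildeGraph_le_gradGraph hp)]
    exact ENNReal.ofReal_le_ofReal (by gcongr)
  · filter_upwards [hp1] with x hx h
    exact hx h.2

theorem relCap_eq_zero (hΩ : IsOpen Ω) {A : Set (E N)} (hA : A ⊆ closure Ω)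
    (h : ∀ r : ℝ, 0 < r → SqrtCapLE Ω A r) : relCap Ω A = 0 := by
  refine le_antisymm (ENNReal.le_of_forall_pos_le_add fun ε hε _ => ?_) zero_le
  refine ((h (√ε) (Real.sqrt_pos.2 hε)).relCap_le hΩ hA).trans ?_
  rw [Real.sq_sqrt ε.coe_nonneg, zero_add, ENNReal.ofReal_coe_nnreal]

/-- Chebyshev's inequality: the part of the set in `Ω` lies, up to a null set, where the potential
is at least `1`, and the potential has small `L²` norm. -/
theorem volume_eq_zero_of_sqrtCapLE (hΩ : IsOpen Ω) {A : Set (E N)}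
    (h : ∀ r : ℝ, 0 < r → SqrtCapLE Ω A r) : (volume : Measure (E N)).restrict Ω A = 0 := by
  refine le_antisymm (ENNReal.le_of_forall_pos_le_add fun ε hε _ => ?_) zero_le
  obtain ⟨U, hU, hAU, p, hp, hp0, hp1, hpr⟩ := h (√ε) (Real.sqrt_pos.2 hε)
  have h1 : (volume : Measure (E N)).restrict Ω A ≤
      (volume : Measure (E N)).restrict Ω {x | (1 : ℝ≥0∞) ≤ ‖p.fst x‖ₑ} := by
    refine measure_mono_ae ?_
    filter_upwards [hp1, ae_restrict_mem hΩ.measurableSet] with x hx hxΩ hxA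
    have h2 := hx (hAU ⟨hxA, subset_closure hxΩ⟩)
    change (1 : ℝ≥0∞) ≤ ‖p.fst x‖ₑ
    rw [← ofReal_norm, ENNReal.one_le_ofReal]
    exact h2.trans (Real.le_norm_self _)
  have h2 := meas_ge_le_mul_pow_eLpNorm_enorm ((volume : Measure (E N)).restrict Ω)
    (two_ne_zero) (ENNReal.ofNat_ne_top) (Lp.aestronglyMeasurable p.fst) one_ne_zero (by simp)
  refine h1.trans (h2.trans ?_)
  have h3 : ‖p.fst‖ ≤ √ε := (WithLp.norm_fst_le _ p).trans hpr
  have h4 : eLpNorm p.fst 2 ((volume : Measure (E N)).restrict Ω) ≤ ENNReal.ofReal (√ε) := by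
    rw [← ENNReal.ofReal_toReal (Lp.eLpNorm_ne_top p.fst), ← Lp.norm_def]
    exact ENNReal.ofReal_le_ofReal h3
  simp only [inv_one, one_pow, one_mul, ENNReal.toReal_ofNat, ENNReal.rpow_ofNat, zero_add]
  calc _ ≤ ENNReal.ofReal (√ε) ^ 2 := by gcongr
    _ = ε := by
      rw [← ENNReal.ofReal_pow (Real.sqrt_nonneg _), Real.sq_sqrt ε.coe_nonneg,
        ENNReal.ofReal_coe_nnreal]

/-- The Borel-Cantelli lemma for the capacity. -/
theorem sqrtCapLE_limsup {A : ℕ → Set (E N)} (hA : ∀ n, SqrtCapLE Ω (A n) (2 * (1 / 2) ^ n))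
    (m : ℕ) : SqrtCapLE Ω (⋃ n, A (n + m)) (4 * (1 / 2) ^ m) := by
  refine sqrtCapLE_iUnion (fun n => hA (n + m)) ?_
  have h := (hasSum_geometric_two).mul_left (2 * (1 / 2 : ℝ) ^ m)
  rw [show (4 : ℝ) * (1 / 2) ^ m = 2 * (1 / 2) ^ m * 2 by ring]
  exact h.congr_fun fun n => by rw [pow_add]; ring

theorem sqrtCapLE_iInter_iUnion {A : ℕ → Set (E N)}
    (hA : ∀ n, SqrtCapLE Ω (A n) (2 * (1 / 2) ^ n)) {r : ℝ} (hr : 0 < r) :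
    SqrtCapLE Ω (⋂ m, ⋃ n, A (n + m)) r := by
  obtain ⟨m, hm⟩ := exists_pow_lt_of_lt_one (show 0 < r / 4 by positivity)
    (show (1 / 2 : ℝ) < 1 by norm_num)
  refine (sqrtCapLE_limsup hA m).mono
    (Set.inter_subset_left.trans (Set.iInter_subset _ m)) (by linarith)

end Capacity

/-! ### Quasi-continuous representatives: weak type estimate, uniqueness, existence. -/

section QuasiContinuity

theorem isRelQuasiContinuous_iff (hΩ : IsOpen Ω) {g : E N → ℝ} :
    IsRelQuasiContinuous Ω g ↔ ∀ r : ℝ, 0 < r → ∃ U : Set (E N), IsOpen U ∧ SqrtCapLE Ω U r ∧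
      ContinuousOn g (closure Ω \ U) := by
  constructor
  · intro h r hr
    obtain ⟨U, hU, hcap, hg⟩ := h (ENNReal.ofReal (r ^ 2)) (ENNReal.ofReal_pos.2 (by positivity))
    exact ⟨U, hU, (sqrtCapLE_of_relCap_lt hΩ hr hcap).mono (fun x hx => ⟨hx.2, hx.1⟩) le_rfl, hg⟩
  · intro h ε hε
    obtain ⟨δ, hδ, hδε⟩ := ENNReal.lt_iff_exists_nnreal_btwn.1 hε
    have hδ' : (0 : ℝ) < δ := by exact_mod_cast hδ
    obtain ⟨U, hU, hcap, hg⟩ := h (√δ) (Real.sqrt_pos.2 hδ')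
    refine ⟨U, hU, lt_of_le_of_lt ((hcap.mono (fun x hx => hx.1.2) le_rfl).relCap_le hΩ
      Set.inter_subset_left) ?_, hg⟩
    rwa [Real.sq_sqrt δ.coe_nonneg, ENNReal.ofReal_coe_nnreal]

theorem isRelQuasiContinuous_of_continuousOn (hΩ : IsOpen Ω) {g : E N → ℝ}
    (hg : ContinuousOn g (closure Ω)) : IsRelQuasiContinuous Ω g :=
  (isRelQuasiContinuous_iff hΩ).2 fun _ hr =>
    ⟨∅, isOpen_empty, sqrtCapLE_empty hr.le, hg.mono Set.sdiff_subset⟩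

theorem IsRelQuasiContinuous.add (hΩ : IsOpen Ω) {f g : E N → ℝ} (hf : IsRelQuasiContinuous Ω f)
    (hg : IsRelQuasiContinuous Ω g) : IsRelQuasiContinuous Ω (f + g) := by
  rw [isRelQuasiContinuous_iff hΩ] at hf hg ⊢
  intro r hr
  obtain ⟨U, hU, hUr, hfU⟩ := hf (r / 2) (by positivity)
  obtain ⟨V, hV, hVr, hgV⟩ := hg (r / 2) (by positivity)
  exact ⟨U ∪ V, hU.union hV, (hUr.union hVr).mono Set.inter_subset_left (by linarith),
    (hfU.mono fun x hx => ⟨hx.1, fun h => hx.2 (Or.inl h)⟩).add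
      (hgV.mono fun x hx => ⟨hx.1, fun h => hx.2 (Or.inr h)⟩)⟩

theorem IsRelQuasiContinuous.const_smul {g : E N → ℝ}
    (hg : IsRelQuasiContinuous Ω g) (c : ℝ) : IsRelQuasiContinuous Ω (c • g) := fun ε hε => by
  obtain ⟨U, hU, hcap, h⟩ := hg ε hε
  exact ⟨U, hU, hcap, h.const_smul c⟩

theorem IsRqcRep.add (hΩ : IsOpen Ω) {u v : L2 Ω} {f g : E N → ℝ} (hf : IsRqcRep Ω u f)
    (hg : IsRqcRep Ω v g) : IsRqcRep Ω (u + v) (f + g) := by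
  refine ⟨hf.1.add hΩ hg.1, ?_⟩
  filter_upwards [hf.2, hg.2, Lp.coeFn_add u v] with x h1 h2 h3
  rw [h3, Pi.add_apply, Pi.add_apply, h1, h2]

theorem IsRqcRep.const_smul {u : L2 Ω} {f : E N → ℝ} (hf : IsRqcRep Ω u f) (c : ℝ) :
    IsRqcRep Ω (c • u) (c • f) := by
  refine ⟨hf.1.const_smul c, ?_⟩
  filter_upwards [hf.2, Lp.coeFn_smul c u] with x h1 h2
  rw [h2, Pi.smul_apply, Pi.smul_apply, h1]

theorem IsRqcRep.sub (hΩ : IsOpen Ω) {u v : L2 Ω} {f g : E N → ℝ} (hf : IsRqcRep Ω u f)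
    (hg : IsRqcRep Ω v g) : IsRqcRep Ω (u - v) (f - g) := by
  have := hf.add hΩ (hg.const_smul (-1))
  simpa [sub_eq_add_neg] using this

/-- The weak type estimate for quasi-continuous representatives. -/
theorem IsRqcRep.sqrtCapLE (hΩ : IsOpen Ω) {p : GradSpace Ω} (hp : p ∈ tildeGraph Ω)
    {g : E N → ℝ} (hg : IsRqcRep Ω p.fst g) {t r : ℝ} (ht : 0 < t) (hr : ‖p‖ < t * r) :
    SqrtCapLE Ω {x | t < |g x|} r := by
  -- Chosen so that `(‖p‖ + t δ) / t + δ = r`: one `δ` for passing to `|p|`, one for the exceptional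
  -- set.
  set δ := (t * r - ‖p‖) / (2 * t) with hδ
  have hδ0 : 0 < δ := div_pos (by linarith) (by positivity)
  obtain ⟨q, hq, hqp, hqn⟩ := exists_abs_mem_tildeGraph hΩ hp (r := ‖p‖ + t * δ)
    (by nlinarith)
  obtain ⟨U, hU, ⟨U', hU', hUU', e, he, he0, he1, hen⟩, hgU⟩ :=
    (isRelQuasiContinuous_iff hΩ).1 hg.1 δ hδ0
  obtain ⟨V, hV, hVg⟩ := continuousOn_iff'.1 hgU.abs (Set.Ioi t) isOpen_Ioi
  have hmem : ∀ x ∈ closure Ω, x ∉ U → (x ∈ V ↔ t < |g x|) := fun x hx hxU => by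
    have := Set.ext_iff.1 hVg x
    constructor
    · intro hxV; exact (this.2 ⟨hxV, hx, hxU⟩).1
    · intro hxt; exact (this.1 ⟨hxt, hx, hxU⟩).1
  have hcoe : ∀ᵐ x ∂((volume : Measure (E N)).restrict Ω),
      (t⁻¹ • q + e).fst x = t⁻¹ * |p.fst x| + e.fst x := by
    filter_upwards [Lp.coeFn_add (t⁻¹ • q.fst) e.fst, Lp.coeFn_smul t⁻¹ q.fst,
      Lp.coeFn_abs p.fst] with x h1 h2 h3
    rw [WithLp.add_fst, WithLp.smul_fst, h1, Pi.add_apply, h2, Pi.smul_apply, hqp, h3, smul_eq_mul]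
  -- Off `U` the superlevel set is relatively open and `|p| / t` exceeds `1` a.e. there; on `U` the
  -- potential `e` takes over.
  refine ⟨V ∪ U, hV.union hU, ?_, t⁻¹ • q + e, add_mem (Submodule.smul_mem _ _ hq) he, ?_, ?_, ?_⟩
  · rintro x ⟨hx, hxΩ⟩
    by_cases hxU : x ∈ U
    · exact Or.inr hxU
    · exact Or.inl ((hmem x hxΩ hxU).2 hx)
  · filter_upwards [hcoe, he0] with x h1 h2
    rw [h1]
    positivity
  · filter_upwards [hcoe, he0, he1, hg.2, ae_restrict_mem hΩ.measurableSet] with x h1 h2 h3 h4 h5 hx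
    rw [h1]
    by_cases hxU : x ∈ U
    · have h6 := h3 (hUU' ⟨hxU, subset_closure h5⟩)
      have h7 : 0 ≤ t⁻¹ * |p.fst x| := by positivity
      linarith
    · have h6 := (hmem x (subset_closure h5) hxU).1 (hx.resolve_right hxU)
      rw [h4] at h6
      have h7 : 1 ≤ t⁻¹ * |p.fst x| := by
        rw [inv_mul_eq_div, one_le_div ht]
        exact h6.le
      linarith
  · refine (norm_add_le _ _).trans ?_
    rw [norm_smul, Real.norm_of_nonneg (inv_nonneg.2 ht.le)]
    have h1 : t⁻¹ * ‖q‖ ≤ t⁻¹ * (‖p‖ + t * δ) := by gcongr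
    have h2 : t⁻¹ * (‖p‖ + t * δ) + δ = r := by
      rw [hδ]; field_simp; ring
    linarith

/-- Quasi-continuous representatives are unique up to sets of zero relative capacity. -/
theorem IsRqcRep.sqrtCapLE_ne (hΩ : IsOpen Ω) {u : L2 Ω} {f g : E N → ℝ} (hf : IsRqcRep Ω u f)
    (hg : IsRqcRep Ω u g) {r : ℝ} (hr : 0 < r) : SqrtCapLE Ω {x | f x ≠ g x} r := by
  have h := hf.sub hΩ hg
  rw [sub_self] at h
  -- `f - g` represents `0`, so the weak type estimate bounds each superlevel set by an arbitrary
  -- positive number; a geometric series sums them to `r`.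
  have h1 := sqrtCapLE_iUnion (Ω := Ω) (A := fun n : ℕ => {x | 1 / ((n : ℝ) + 1) < |(f - g) x|})
    (r := fun n => (r / 2) * (1 / 2) ^ n) (R := r) (fun n =>
      IsRqcRep.sqrtCapLE hΩ (p := 0) (zero_mem _) h (by positivity) (by simp; positivity)) (by
      have := hasSum_geometric_two.mul_left (r / 2)
      rwa [div_mul_cancel₀ _ two_ne_zero] at this)
  refine h1.mono (fun x hx => ?_) le_rfl
  obtain ⟨n, hn⟩ := exists_nat_one_div_lt (abs_pos.2 (sub_ne_zero.2 hx.1))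
  exact Set.mem_iUnion.2 ⟨n, hn⟩

theorem exists_continuousOn_isRqcRep (hΩ : IsOpen Ω) {p : GradSpace Ω} (hp : p ∈ ccGraph Ω) :
    ∃ g : E N → ℝ, ContinuousOn g (closure Ω) ∧ IsRqcRep Ω p.fst g := by
  obtain ⟨-, g, hg, -, hgp⟩ := hp
  refine ⟨g, hg, isRelQuasiContinuous_of_continuousOn hΩ hg, ?_⟩
  filter_upwards [hgp] with x hx
  exact hx.symm

/-- Every function in `H̃¹(Ω)` has a quasi-continuous representative. -/
theorem exists_isRqcRep (hΩ : IsOpen Ω) {p : GradSpace Ω} (hp : p ∈ tildeGraph Ω) :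
    ∃ g : E N → ℝ, IsRqcRep Ω p.fst g := by
  -- The rate `4⁻ⁿ` is split between level and capacity: consecutive representatives differ by more
  -- than `2⁻ⁿ` only on a set of capacity root at most `2 · 2⁻ⁿ`, and both are summable.
  have happrox : ∀ n : ℕ, ∃ q ∈ ccGraph Ω, ‖p - q‖ < (1 / 4) ^ n / 2 := fun n => by
    obtain ⟨q, hq, h⟩ := Metric.mem_closure_iff.1 hp ((1 / 4) ^ n / 2) (by positivity)
    exact ⟨q, hq, by rwa [← dist_eq_norm]⟩
  choose s hs hsp using happrox
  choose g hgc hg using fun n => exists_continuousOn_isRqcRep hΩ (hs n)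
  have hstep : ∀ n, ‖s (n + 1) - s n‖ < (1 / 2) ^ n * (2 * (1 / 2) ^ n) := fun n => by
    have h1 : s (n + 1) - s n = (p - s n) - (p - s (n + 1)) := by abel
    have h2 : (1 / 2 : ℝ) ^ n * (2 * (1 / 2) ^ n) = 2 * (1 / 4) ^ n := by
      rw [mul_left_comm, ← mul_pow]; norm_num
    have h3 := hsp (n + 1)
    rw [pow_succ] at h3
    have h4 : (0 : ℝ) < (1 / 4) ^ n := by positivity
    rw [h1, h2]
    linarith [norm_sub_le (p - s n) (p - s (n + 1)), hsp n]
  have hA : ∀ n, SqrtCapLE Ω {x | (1 / 2) ^ n < |(g (n + 1) - g n) x|} (2 * (1 / 2) ^ n) := fun n =>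
    IsRqcRep.sqrtCapLE hΩ (p := s (n + 1) - s n)
      (sub_mem (ccGraph_le_tildeGraph (hs _)) (ccGraph_le_tildeGraph (hs _)))
      ((hg (n + 1)).sub hΩ (hg n)) (by positivity) (hstep n)
  choose U hU hAU hUcap using fun n => (hA n).exists_isOpen
  -- Where the sequence diverges the value is arbitrary; within `closure Ω` this happens only on a
  -- set of zero capacity.
  set f : E N → ℝ := fun x => limUnder atTop fun n => g n x with hf
  have hbound : ∀ m x, x ∈ closure Ω → x ∉ ⋃ n, U (n + m) → ∀ n,
      dist (g (n + m) x) (g (n + 1 + m) x) ≤ (1 / 2) ^ m * (1 / 2) ^ n := fun m x hx hxU n => by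
    have h1 : x ∉ U (n + m) := fun h => hxU (Set.mem_iUnion.2 ⟨n, h⟩)
    have h2 : ¬ (1 / 2 : ℝ) ^ (n + m) < |(g (n + m + 1) - g (n + m)) x| :=
      fun h => h1 (hAU (n + m) ⟨h, hx⟩)
    rw [dist_comm, Real.dist_eq, ← pow_add, add_right_comm n 1 m, add_comm m n]
    exact not_lt.1 h2
  have hlim : ∀ m x, x ∈ closure Ω → x ∉ ⋃ n, U (n + m) →
      Tendsto (fun n => g (n + m) x) atTop (𝓝 (f x)) := fun m x hx hxU => by
    obtain ⟨a, ha⟩ := cauchySeq_tendsto_of_complete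
      (cauchySeq_of_le_geometric (1 / 2) _ (by norm_num) (hbound m x hx hxU))
    have ha' : Tendsto (fun n => g n x) atTop (𝓝 a) := (tendsto_add_atTop_iff_nat m).1 ha
    exact (tendsto_nhds_limUnder ⟨a, ha'⟩).comp (tendsto_add_atTop_nat m)
  refine ⟨f, (isRelQuasiContinuous_iff hΩ).2 fun r hr => ?_, ?_⟩
  · obtain ⟨m, hm⟩ := exists_pow_lt_of_lt_one (show 0 < r / 4 by positivity)
      (show (1 / 2 : ℝ) < 1 by norm_num)
    refine ⟨⋃ n, U (n + m), isOpen_iUnion fun n => hU _,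
      (sqrtCapLE_limsup hUcap m).mono Set.inter_subset_left (by linarith), ?_⟩
    have hunif : TendstoUniformlyOn (fun n => g (n + m)) f atTop
        (closure Ω \ ⋃ n, U (n + m)) := by
      rw [Metric.tendstoUniformlyOn_iff]
      intro ε hε
      have h0 : Tendsto (fun n : ℕ => (1 / 2 : ℝ) ^ m * (1 / 2) ^ n / (1 - 1 / 2)) atTop (𝓝 0) := by
        have := ((tendsto_pow_atTop_nhds_zero_of_lt_one (r := (1 / 2 : ℝ)) (by norm_num)
          (by norm_num)).const_mul ((1 / 2) ^ m)).div_const (1 - 1 / 2)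
        simpa using this
      filter_upwards [h0.eventually (gt_mem_nhds hε)] with n hn x hx
      rw [dist_comm]
      exact (dist_le_of_le_geometric_of_tendsto (1 / 2) _ (by norm_num) (hbound m x hx.1 hx.2)
        (hlim m x hx.1 hx.2) n).trans_lt hn
    exact hunif.continuousOn (Eventually.of_forall fun n => (hgc _).mono Set.sdiff_subset).frequently
  · have hnull : ∀ᵐ x ∂((volume : Measure (E N)).restrict Ω), x ∉ ⋂ m, ⋃ n, U (n + m) :=
      measure_eq_zero_iff_ae_notMem.1
        (volume_eq_zero_of_sqrtCapLE hΩ fun r hr => sqrtCapLE_iInter_iUnion hUcap hr)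
    have hL2 : Tendsto (fun n => (s n).fst) atTop (𝓝 p.fst) := by
      have h1 : Tendsto s atTop (𝓝 p) := by
        rw [tendsto_iff_norm_sub_tendsto_zero]
        have h0 := (tendsto_pow_atTop_nhds_zero_of_lt_one (r := (1 / 4 : ℝ)) (by norm_num)
          (by norm_num)).div_const 2
        rw [zero_div] at h0
        exact squeeze_zero (fun _ => norm_nonneg _)
          (fun n => by rw [norm_sub_rev]; exact (hsp n).le) h0
      exact ((WithLp.fstL 2 ℝ (L2 Ω) (L2Vec Ω)).continuous.tendsto p).comp h1
    -- The pointwise limit is identified with `p` through an a.e. convergent subsequence.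
    obtain ⟨ns, hns, hae⟩ := (tendstoInMeasure_of_tendsto_Lp hL2).exists_seq_tendsto_ae
    filter_upwards [hnull, hae, ae_all_iff.2 fun n => (hg n).2, ae_restrict_mem hΩ.measurableSet]
      with x h1 h2 h3 h4
    simp only [Set.mem_iInter, not_forall] at h1
    obtain ⟨m, hm⟩ := h1
    have h5 : Tendsto (fun n => g n x) atTop (𝓝 (f x)) :=
      (tendsto_add_atTop_iff_nat m).1 (hlim m x (subset_closure h4) hm)
    refine tendsto_nhds_unique (h5.comp hns.tendsto_atTop) (h2.congr fun n => ?_)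
    exact (h3 _).symm

theorem isRqcRep_rqcRep (hΩ : IsOpen Ω) {p : GradSpace Ω} (hp : p ∈ tildeGraph Ω) :
    IsRqcRep Ω p.fst (rqcRep Ω p.fst) := by
  have h := exists_isRqcRep hΩ hp
  rw [rqcRep, dif_pos h]
  exact h.choose_spec

end QuasiContinuity

/-! ### Smooth measures ignore sets of zero capacity. -/

section SmoothMeasures

variable {μ : Measure (E N)}

/-- `A` need not be Borel, while smoothness speaks of Borel sets only; the part of `A` in `∂Ω` is
therefore enclosed in a trace of a `G_δ` set that also has zero capacity. -/
theorem IsSmoothMeasure.ae_notMem (hΩ : IsOpen Ω) (hμ : IsSmoothMeasure Ω μ) {A : Set (E N)}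
    (hA : ∀ r : ℝ, 0 < r → SqrtCapLE Ω A r) : ∀ᵐ x ∂(μ.restrict (frontier Ω)), x ∉ A := by
  have hr : ∀ n : ℕ, (0 : ℝ) < 1 / ((n : ℝ) + 1) := fun n => by positivity
  choose U hU hAU hcap using fun n : ℕ => (hA _ (hr n)).exists_isOpen
  have hfr : MeasurableSet (frontier Ω) := isClosed_frontier.measurableSet
  have h0 : μ (frontier Ω ∩ ⋂ n, U n) = 0 := by
    refine hμ.null_of_relCap_zero _ Set.inter_subset_left
      (hfr.inter (MeasurableSet.iInter fun n => (hU n).measurableSet))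
      (relCap_eq_zero hΩ (Set.inter_subset_left.trans frontier_subset_closure) fun r hr' => ?_)
    obtain ⟨n, hn⟩ := exists_nat_one_div_lt hr'
    exact (hcap n).mono (fun x hx => Set.mem_iInter.1 hx.1.2 n) hn.le
  rw [← measure_eq_zero_iff_ae_notMem, Measure.restrict_apply' hfr]
  exact measure_mono_null (t := frontier Ω ∩ ⋂ n, U n) (fun x hx => ⟨hx.2, Set.mem_iInter.2 fun n =>
    hAU n ⟨hx.1, frontier_subset_closure hx.2⟩⟩) h0

/-- Makes the arbitrary choice in `rqcRep` harmless: boundary values become linear in `u` up to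
`μ`-null sets. -/
theorem IsSmoothMeasure.ae_eq (hΩ : IsOpen Ω) (hμ : IsSmoothMeasure Ω μ) {u : L2 Ω}
    {f g : E N → ℝ} (hf : IsRqcRep Ω u f) (hg : IsRqcRep Ω u g) :
    f =ᵐ[μ.restrict (frontier Ω)] g := by
  filter_upwards [hμ.ae_notMem hΩ fun r hr => hf.sqrtCapLE_ne hΩ hg hr] with x hx
  exact not_not.1 hx

/-- Fast convergence in `H̃¹(Ω)` implies convergence almost everywhere on the boundary. -/
theorem IsSmoothMeasure.ae_tendsto (hΩ : IsOpen Ω) (hμ : IsSmoothMeasure Ω μ) {p : GradSpace Ω}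
    (hp : p ∈ tildeGraph Ω) {q : ℕ → GradSpace Ω} (hq : ∀ n, q n ∈ tildeGraph Ω)
    (hlim : ∀ n, ‖q n - p‖ ≤ (1 / 4) ^ n) :
    ∀ᵐ x ∂(μ.restrict (frontier Ω)),
      Tendsto (fun n => rqcRep Ω (q n).fst x) atTop (𝓝 (rqcRep Ω p.fst x)) := by
  have hA : ∀ n, SqrtCapLE Ω {x | (1 / 2) ^ n < |(rqcRep Ω (q n).fst - rqcRep Ω p.fst) x|}
      (2 * (1 / 2) ^ n) := fun n => by
    refine IsRqcRep.sqrtCapLE hΩ (p := q n - p) (sub_mem (hq n) hp)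
      ((isRqcRep_rqcRep hΩ (hq n)).sub hΩ (isRqcRep_rqcRep hΩ hp)) (by positivity) ?_
    have h2 : (1 / 2 : ℝ) ^ n * (2 * (1 / 2) ^ n) = 2 * (1 / 4) ^ n := by
      rw [mul_left_comm, ← mul_pow]; norm_num
    have h4 : (0 : ℝ) < (1 / 4) ^ n := by positivity
    linarith [hlim n]
  filter_upwards [hμ.ae_notMem hΩ fun r hr => sqrtCapLE_iInter_iUnion hA hr] with x hx
  simp only [Set.mem_iInter, not_forall] at hx
  obtain ⟨m, hm⟩ := hx
  rw [← tendsto_add_atTop_iff_nat m, tendsto_iff_norm_sub_tendsto_zero]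
  have h0 := (tendsto_pow_atTop_nhds_zero_of_lt_one (r := (1 / 2 : ℝ)) (by norm_num)
    (by norm_num)).comp (tendsto_add_atTop_nat m)
  refine squeeze_zero (fun _ => norm_nonneg _) (fun n => ?_) h0
  exact not_lt.1 fun h => hm (Set.mem_iUnion.2 ⟨n, h⟩)

end SmoothMeasures

/-! ### Closedness of the Robin form, density of its domain, and the two operators. -/

section RobinForm

variable {μ : Measure (E N)}

/-- The space `L²(∂Ω, μ)`. -/
abbrev L2Bdry (Ω : Set (E N)) (μ : Measure (E N)) : Type := Lp ℝ 2 (μ.restrict (frontier Ω))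

theorem rqcRep_add_ae_eq (hΩ : IsOpen Ω) (hμ : IsSmoothMeasure Ω μ) {p q : GradSpace Ω}
    (hp : p ∈ tildeGraph Ω) (hq : q ∈ tildeGraph Ω) :
    rqcRep Ω (p + q).fst =ᵐ[μ.restrict (frontier Ω)] rqcRep Ω p.fst + rqcRep Ω q.fst :=
  hμ.ae_eq hΩ (isRqcRep_rqcRep hΩ (add_mem hp hq))
    ((isRqcRep_rqcRep hΩ hp).add hΩ (isRqcRep_rqcRep hΩ hq))

theorem rqcRep_smul_ae_eq (hΩ : IsOpen Ω) (hμ : IsSmoothMeasure Ω μ) {p : GradSpace Ω}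
    (hp : p ∈ tildeGraph Ω) (c : ℝ) :
    rqcRep Ω (c • p).fst =ᵐ[μ.restrict (frontier Ω)] c • rqcRep Ω p.fst :=
  hμ.ae_eq hΩ (isRqcRep_rqcRep hΩ (Submodule.smul_mem _ c hp))
    ((isRqcRep_rqcRep hΩ hp).const_smul c)

/-- The form domain `𝓕^μ` of the functions together with their gradients and boundary values. -/
def robinGraph (hΩ : IsOpen Ω) (hμ : IsSmoothMeasure Ω μ) :
    Submodule ℝ (WithLp 2 (GradSpace Ω × L2Bdry Ω μ)) where
  carrier := {z | z.fst ∈ tildeGraph Ω ∧ z.snd =ᵐ[μ.restrict (frontier Ω)] rqcRep Ω z.fst.fst}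
  zero_mem' := by
    refine ⟨zero_mem _, ?_⟩
    have h := rqcRep_smul_ae_eq hΩ hμ (zero_mem (tildeGraph Ω)) 0
    filter_upwards [h, Lp.coeFn_zero ℝ 2 (μ.restrict (frontier Ω))] with x h1 h2
    rw [zero_smul] at h1
    rw [WithLp.zero_snd, WithLp.zero_fst, h2, h1]
    simp
  add_mem' := by
    rintro z w ⟨hz, hz'⟩ ⟨hw, hw'⟩
    refine ⟨add_mem hz hw, ?_⟩
    filter_upwards [hz', hw', rqcRep_add_ae_eq hΩ hμ hz hw, Lp.coeFn_add z.snd w.snd]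
      with x h1 h2 h3 h4
    rw [WithLp.add_snd, WithLp.add_fst, h3, h4, Pi.add_apply, Pi.add_apply, h1, h2]
  smul_mem' := by
    rintro c z ⟨hz, hz'⟩
    refine ⟨Submodule.smul_mem _ c hz, ?_⟩
    filter_upwards [hz', rqcRep_smul_ae_eq hΩ hμ hz c, Lp.coeFn_smul c z.snd] with x h1 h2 h3
    rw [WithLp.smul_snd, WithLp.smul_fst, h2, h3, Pi.smul_apply, Pi.smul_apply, h1]

/-- This is the closedness of the Robin form. Along a fast subsequence the representatives converge
`μ`-a.e. to that of the limit; along a further one they converge a.e. to the `L²(μ)` limit, so the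
two agree. -/
theorem isClosed_robinGraph (hΩ : IsOpen Ω) (hμ : IsSmoothMeasure Ω μ) :
    IsClosed (robinGraph hΩ hμ : Set (WithLp 2 (GradSpace Ω × L2Bdry Ω μ))) := by
  refine IsSeqClosed.isClosed fun z w hz hzw => ?_
  have h1 : Tendsto (fun n => (z n).fst) atTop (𝓝 w.fst) :=
    ((WithLp.fstL 2 ℝ (GradSpace Ω) (L2Bdry Ω μ)).continuous.tendsto w).comp hzw
  have h2 : Tendsto (fun n => (z n).snd) atTop (𝓝 w.snd) :=
    ((WithLp.sndL 2 ℝ (GradSpace Ω) (L2Bdry Ω μ)).continuous.tendsto w).comp hzw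
  have hw : w.fst ∈ tildeGraph Ω :=
    (Submodule.isClosed_topologicalClosure (ccGraph Ω)).mem_of_tendsto h1
      (Eventually.of_forall fun n => (hz n).1)
  refine ⟨hw, ?_⟩
  obtain ⟨φ, hφ, hfast⟩ := extraction_forall_of_eventually'
    (P := fun n k => ‖(z k).fst - w.fst‖ ≤ (1 / 4) ^ n) fun n => by
      have h0 := tendsto_iff_norm_sub_tendsto_zero.1 h1
      exact eventually_atTop.1 ((h0.eventually (gt_mem_nhds (show (0 : ℝ) < (1 / 4) ^ n by
        positivity))).mono fun k hk => hk.le)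
  have hae := hμ.ae_tendsto hΩ hw (fun n => (hz (φ n)).1) hfast
  obtain ⟨ns, hns, hae'⟩ :=
    (tendstoInMeasure_of_tendsto_Lp (h2.comp hφ.tendsto_atTop)).exists_seq_tendsto_ae
  filter_upwards [hae, hae', ae_all_iff.2 fun n => (hz n).2] with x h3 h4 h5
  refine tendsto_nhds_unique (h4.congr fun n => ?_) (h3.comp hns.tendsto_atTop)
  exact h5 _

theorem mem_robinDomain_iff (hΩ : IsOpen Ω) (hμ : IsSmoothMeasure Ω μ) {u : L2 Ω} :
    u ∈ robinDomain Ω μ ↔ ∃ z ∈ robinGraph hΩ hμ, z.fst.fst = u := by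
  constructor
  · rintro ⟨hu, hm⟩
    obtain ⟨p, hp, rfl⟩ := (mem_tildeH1_iff hΩ).1 hu
    exact ⟨WithLp.toLp 2 (p, hm.toLp), ⟨hp, hm.coeFn_toLp⟩, rfl⟩
  · rintro ⟨z, ⟨hz, hz'⟩, rfl⟩
    exact ⟨(mem_tildeH1_iff hΩ).2 ⟨_, hz, rfl⟩, (memLp_congr_ae hz').1 (Lp.memLp z.snd)⟩

/-- A continuous function vanishing off a compact set is bounded on `∂Ω`, hence square integrable
for the finite `μ`, and it is its own quasi-continuous representative. -/
theorem exists_mem_robinGraph_of_mem_ccGraph [IsFiniteMeasure μ] (hΩ : IsOpen Ω)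
    (hμ : IsSmoothMeasure Ω μ) {p : GradSpace Ω} (hp : p ∈ ccGraph Ω) :
    ∃ z ∈ robinGraph hΩ hμ, z.fst = p := by
  have hpt := ccGraph_le_tildeGraph hp
  obtain ⟨-, g, hg, ⟨K, hK, hKΩ, hgK⟩, hgp⟩ := hp
  have hrep : IsRqcRep Ω p.fst g := ⟨isRelQuasiContinuous_of_continuousOn hΩ hg, by
    filter_upwards [hgp] with x hx using hx.symm⟩
  obtain ⟨C, hC⟩ := hK.exists_bound_of_continuousOn (hg.mono hKΩ)
  have hm : MemLp g 2 (μ.restrict (frontier Ω)) := by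
    refine MemLp.of_bound ((hg.mono frontier_subset_closure).aestronglyMeasurable
      isClosed_frontier.measurableSet) (max C 0) ?_
    filter_upwards [ae_restrict_mem isClosed_frontier.measurableSet] with x hx
    by_cases hxK : x ∈ K
    · exact (hC x hxK).trans (le_max_left _ _)
    · rw [hgK x ⟨frontier_subset_closure hx, hxK⟩, norm_zero]
      exact le_max_right _ _
  refine ⟨WithLp.toLp 2 (p, hm.toLp), ⟨hpt, ?_⟩, rfl⟩
  exact hm.coeFn_toLp.trans (hμ.ae_eq hΩ hrep (isRqcRep_rqcRep hΩ hpt))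

/-- Test functions are Sobolev functions. -/
theorem exists_mem_ccGraph_of_testFunction {φ : E N → ℝ} (hφ : ContDiff ℝ ∞ φ)
    (hc : HasCompactSupport φ) (hs : tsupport φ ⊆ Ω) :
    ∃ p ∈ ccGraph Ω, ∀ᵐ x ∂((volume : Measure (E N)).restrict Ω), p.fst x = φ x := by
  have hd : ∀ i : Fin N, Continuous fun x => fderiv ℝ φ x (EuclideanSpace.single i 1) := fun i =>
    (hφ.continuous_fderiv (by simp)).clm_apply continuous_const
  have hm : MemLp φ 2 ((volume : Measure (E N)).restrict Ω) :=
    (hφ.continuous.memLp_of_hasCompactSupport hc).restrict Ω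
  set G : E N → E N := fun x => WithLp.toLp 2 fun i => fderiv ℝ φ x (EuclideanSpace.single i 1)
    with hG
  have hGc : Continuous G := (PiLp.continuous_toLp 2 _).comp (continuous_pi hd)
  have hGs : HasCompactSupport G := hc.mono' fun x hx => by
    by_contra hxs
    refine hx ?_
    have : fderiv ℝ φ x = 0 :=
      image_eq_zero_of_notMem_tsupport fun h => hxs (tsupport_fderiv_subset ℝ h)
    ext i
    simp [hG, this]
  have hGm : MemLp G 2 ((volume : Measure (E N)).restrict Ω) :=
    (hGc.memLp_of_hasCompactSupport hGs).restrict Ω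
  refine ⟨WithLp.toLp 2 (hm.toLp, hGm.toLp), ⟨?_, φ, hφ.continuous.continuousOn,
    ⟨tsupport φ, hc, hs.trans subset_closure,
      fun x hx => image_eq_zero_of_notMem_tsupport hx.2⟩, hm.coeFn_toLp⟩, hm.coeFn_toLp⟩
  intro ψ hψ hψc hψs i
  have hdψ : Continuous fun x => fderiv ℝ ψ x (EuclideanSpace.single i 1) :=
    (hψ.continuous_fderiv (by simp)).clm_apply continuous_const
  have hip := integral_mul_fderiv_eq_neg_fderiv_mul_of_integrable (μ := volume)
    (f := φ) (g := ψ) (v := EuclideanSpace.single i 1)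
    (((hd i).mul hψ.continuous).integrable_of_hasCompactSupport hψc.mul_left)
    ((hφ.continuous.mul hdψ).integrable_of_hasCompactSupport hc.mul_right)
    ((hφ.continuous.mul hψ.continuous).integrable_of_hasCompactSupport hψc.mul_left)
    (fun x _ => hφ.differentiable (by simp) x) (fun x _ => hψ.differentiable (by simp) x)
  rw [← setIntegral_mul_fderiv_eq_integral hψs, ← setIntegral_mul_eq_integral hψs] at hip
  convert hip using 1
  · refine integral_congr_ae ?_
    filter_upwards [hm.coeFn_toLp] with x hx
    exact congrArg (fun t => t * fderiv ℝ ψ x (EuclideanSpace.single i 1)) hx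
  · congr 1
    refine integral_congr_ae ?_
    filter_upwards [hGm.coeFn_toLp] with x hx
    exact congrArg (fun v : E N => v i * ψ x) hx

/-- The values of a subspace of the Sobolev functions are dense in `L²(Ω)` if it contains the test
functions. -/
theorem dense_of_forall_ccGraph (hΩ : IsOpen Ω) (S : Submodule ℝ (L2 Ω))
    (hS : ∀ p ∈ ccGraph Ω, p.fst ∈ S) : Dense (S : Set (L2 Ω)) := by
  rw [Submodule.dense_iff_topologicalClosure_eq_top, Submodule.topologicalClosure_eq_top_iff,
    Submodule.eq_bot_iff]
  intro u hu
  have hloc : LocallyIntegrableOn u Ω volume :=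
    locallyIntegrableOn_of_locallyIntegrable_restrict
      ((Lp.memLp u).locallyIntegrable (by norm_num))
  have h0 := hΩ.ae_eq_zero_of_integral_contDiff_smul_eq_zero hloc fun φ hφ hc hs => by
    obtain ⟨p, hp, hpφ⟩ := exists_mem_ccGraph_of_testFunction hφ hc hs
    have h1 : inner ℝ u p.fst = 0 := (Submodule.mem_orthogonal' _ _).1 hu _ (hS p hp)
    rw [inner_L2_eq] at h1
    simp only [smul_eq_mul, mul_comm (φ _)]
    rw [← setIntegral_mul_eq_integral hs, ← h1]
    refine integral_congr_ae ?_
    filter_upwards [hpφ] with x hx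
    rw [hx]
  refine Lp.ext ?_
  filter_upwards [(ae_restrict_iff' hΩ.measurableSet).2 h0,
    Lp.coeFn_zero ℝ 2 ((volume : Measure (E N)).restrict Ω)] with x h1 h2
  rw [h1, h2]
  rfl

/-- The embedding of `H̃¹(Ω)` into `L²(Ω)`. -/
def tildeIncl (Ω : Set (E N)) : tildeGraph Ω →L[ℝ] L2 Ω :=
  (WithLp.fstL 2 ℝ (L2 Ω) (L2Vec Ω)).comp (tildeGraph Ω).subtypeL

/-- The weak gradient on `H̃¹(Ω)`. -/
def tildeGrad (Ω : Set (E N)) : tildeGraph Ω →L[ℝ] L2Vec Ω :=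
  (WithLp.sndL 2 ℝ (L2 Ω) (L2Vec Ω)).comp (tildeGraph Ω).subtypeL

/-- The form domain `𝓕^μ`, as a Hilbert space with the form norm. -/
def RobinSpace (hΩ : IsOpen Ω) (hμ : IsSmoothMeasure Ω μ) : Type := robinGraph hΩ hμ

instance (hΩ : IsOpen Ω) (hμ : IsSmoothMeasure Ω μ) : NormedAddCommGroup (RobinSpace hΩ hμ) :=
  inferInstanceAs (NormedAddCommGroup (robinGraph hΩ hμ))

instance (hΩ : IsOpen Ω) (hμ : IsSmoothMeasure Ω μ) : InnerProductSpace ℝ (RobinSpace hΩ hμ) :=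
  inferInstanceAs (InnerProductSpace ℝ (robinGraph hΩ hμ))

instance (hΩ : IsOpen Ω) (hμ : IsSmoothMeasure Ω μ) : CompleteSpace (RobinSpace hΩ hμ) :=
  (isClosed_robinGraph hΩ hμ).completeSpace_coe

/-- The embedding of `𝓕^μ` into `H̃¹(Ω)`. -/
def robinIncl (hΩ : IsOpen Ω) (hμ : IsSmoothMeasure Ω μ) :
    RobinSpace hΩ hμ →L[ℝ] tildeGraph Ω :=
  ((WithLp.fstL 2 ℝ (GradSpace Ω) (L2Bdry Ω μ)).comp (robinGraph hΩ hμ).subtypeL).codRestrict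
    (tildeGraph Ω) fun z => z.2.1

/-- The boundary values of the functions in `𝓕^μ`. -/
def robinTrace (hΩ : IsOpen Ω) (hμ : IsSmoothMeasure Ω μ) :
    RobinSpace hΩ hμ →L[ℝ] L2Bdry Ω μ :=
  (WithLp.sndL 2 ℝ (GradSpace Ω) (L2Bdry Ω μ)).comp (robinGraph hΩ hμ).subtypeL

/-- The pull-back of an inner product, as a bilinear form. -/
def innerComp {V H : Type*} [NormedAddCommGroup V] [InnerProductSpace ℝ V] [NormedAddCommGroup H]
    [InnerProductSpace ℝ H] (T : V →L[ℝ] H) : V →L[ℝ] V →L[ℝ] ℝ :=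
  let J : H →L[ℝ] H →L[ℝ] ℝ := innerSL ℝ
  J.bilinearComp T T

theorem innerComp_apply {V H : Type*} [NormedAddCommGroup V] [InnerProductSpace ℝ V]
    [NormedAddCommGroup H] [InnerProductSpace ℝ H] (T : V →L[ℝ] H) (u v : V) :
    innerComp T u v = inner ℝ (T u) (T v) := rfl

theorem innerComp_symm {V H : Type*} [NormedAddCommGroup V] [InnerProductSpace ℝ V]
    [NormedAddCommGroup H] [InnerProductSpace ℝ H] (T : V →L[ℝ] H) (u v : V) :
    innerComp T u v = innerComp T v u := by
  rw [innerComp_apply, innerComp_apply, real_inner_comm]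

theorem innerComp_self {V H : Type*} [NormedAddCommGroup V] [InnerProductSpace ℝ V]
    [NormedAddCommGroup H] [InnerProductSpace ℝ H] (T : V →L[ℝ] H) (u : V) :
    innerComp T u u = ‖T u‖ ^ 2 := by
  rw [innerComp_apply, real_inner_self_eq_norm_sq]

theorem innerComp_self_nonneg {V H : Type*} [NormedAddCommGroup V] [InnerProductSpace ℝ V]
    [NormedAddCommGroup H] [InnerProductSpace ℝ H] (T : V →L[ℝ] H) (u : V) :
    0 ≤ innerComp T u u :=
  (innerComp_self T u).symm ▸ sq_nonneg _

theorem norm_sq_tildeGraph (u : tildeGraph Ω) :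
    ‖u‖ ^ 2 = ‖tildeIncl Ω u‖ ^ 2 + ‖tildeGrad Ω u‖ ^ 2 :=
  WithLp.prod_norm_sq_eq_of_L2 (u : GradSpace Ω)

theorem norm_sq_robinGraph (hΩ : IsOpen Ω) (hμ : IsSmoothMeasure Ω μ) (z : RobinSpace hΩ hμ) :
    ‖z‖ ^ 2 = ‖robinIncl hΩ hμ z‖ ^ 2 + ‖robinTrace hΩ hμ z‖ ^ 2 :=
  WithLp.prod_norm_sq_eq_of_L2 (z.1 : WithLp 2 (GradSpace Ω × L2Bdry Ω μ))

theorem denseRange_tildeIncl (hΩ : IsOpen Ω) : DenseRange (tildeIncl Ω) := by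
  have := dense_of_forall_ccGraph hΩ (tildeIncl Ω).range
    fun p hp => ⟨⟨p, ccGraph_le_tildeGraph hp⟩, rfl⟩
  rwa [LinearMap.coe_range] at this

theorem denseRange_robinIncl [IsFiniteMeasure μ] (hΩ : IsOpen Ω) (hμ : IsSmoothMeasure Ω μ) :
    DenseRange (robinIncl hΩ hμ) := by
  intro p
  rw [Metric.mem_closure_iff]
  intro ε hε
  obtain ⟨q, hq, h⟩ := Metric.mem_closure_iff.1 p.2 ε hε
  obtain ⟨z, hz, rfl⟩ := exists_mem_robinGraph_of_mem_ccGraph hΩ hμ hq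
  exact ⟨_, ⟨⟨z, hz⟩, rfl⟩, h⟩

theorem dirichletForm_tildeIncl (hΩ : IsOpen Ω) (u v : tildeGraph Ω) :
    dirichletForm Ω (tildeIncl Ω u) (tildeIncl Ω v) = innerComp (tildeGrad Ω) u v :=
  dirichletForm_eq hΩ (tildeGraph_le_gradGraph u.2) (tildeGraph_le_gradGraph v.2)

theorem robinTrace_ae_eq (hΩ : IsOpen Ω) (hμ : IsSmoothMeasure Ω μ) (u : RobinSpace hΩ hμ) :
    robinTrace hΩ hμ u =ᵐ[μ.restrict (frontier Ω)]
      rqcRep Ω (tildeIncl Ω (robinIncl hΩ hμ u)) :=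
  u.2.2

theorem integral_rqcRep_mul_rqcRep (hΩ : IsOpen Ω) (hμ : IsSmoothMeasure Ω μ)
    (u v : RobinSpace hΩ hμ) :
    ∫ x in frontier Ω, rqcRep Ω (tildeIncl Ω (robinIncl hΩ hμ u)) x *
      rqcRep Ω (tildeIncl Ω (robinIncl hΩ hμ v)) x ∂μ =
        inner ℝ (robinTrace hΩ hμ u) (robinTrace hΩ hμ v) := by
  rw [inner_L2_eq]
  refine integral_congr_ae ?_
  filter_upwards [robinTrace_ae_eq hΩ hμ u, robinTrace_ae_eq hΩ hμ v] with x hu hv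
  rw [hu, hv]

theorem exists_neumann_operator (hΩ : IsOpen Ω) :
    ∃ A : L2 Ω →ₗ.[ℝ] L2 Ω, IsSelfAdjoint A ∧
      IsFormOperator (tildeH1 Ω) (dirichletForm Ω) A ∧
      ∀ α : ℝ, 0 < α → ∃ R : L2 Ω →L[ℝ] L2 Ω, IsResolventAt A α R ∧
        ∀ f, ∃ u, R f = tildeIncl Ω u ∧ ∀ v, innerComp (tildeGrad Ω) u v +
          α * inner ℝ (tildeIncl Ω u) (tildeIncl Ω v) = inner ℝ f (tildeIncl Ω v) := by
  refine exists_formOperator (tildeIncl Ω) (denseRange_tildeIncl hΩ) (innerComp (tildeGrad Ω))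
    (innerComp_symm _) (innerComp_self_nonneg _) one_pos (fun u => ?_) ?_
    fun u v => ?_
  · rw [one_mul, norm_sq_tildeGraph, innerComp_self, add_comm]
  · ext u
    rw [mem_tildeH1_iff hΩ]
    exact ⟨fun ⟨p, hp, h⟩ => ⟨⟨p, hp⟩, h⟩, fun ⟨p, h⟩ => ⟨p, p.2, h⟩⟩
  · exact dirichletForm_tildeIncl hΩ u v

/-- The Hilbert norm on the domain carries the full boundary term while the form carries only `c`
times it; since `c ≤ 1`, coercivity holds with constant `c`. -/
theorem exists_robin_operator [IsFiniteMeasure μ] (hΩ : IsOpen Ω) (hμ : IsSmoothMeasure Ω μ)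
    {c : ℝ} (hc : 0 < c) (hc1 : c ≤ 1) :
    ∃ A : L2 Ω →ₗ.[ℝ] L2 Ω, IsSelfAdjoint A ∧
      IsFormOperator (robinDomain Ω μ) (fun u v => dirichletForm Ω u v +
        c * ∫ x in frontier Ω, rqcRep Ω u x * rqcRep Ω v x ∂μ) A ∧
      ∀ α : ℝ, 0 < α → ∃ R : L2 Ω →L[ℝ] L2 Ω, IsResolventAt A α R ∧
        ∀ f, ∃ u, R f = tildeIncl Ω (robinIncl hΩ hμ u) ∧
          ∀ v, innerComp (tildeGrad Ω) (robinIncl hΩ hμ u) (robinIncl hΩ hμ v) +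
            c * inner ℝ (robinTrace hΩ hμ u) (robinTrace hΩ hμ v) +
            α * inner ℝ (tildeIncl Ω (robinIncl hΩ hμ u)) (tildeIncl Ω (robinIncl hΩ hμ v)) =
              inner ℝ f (tildeIncl Ω (robinIncl hΩ hμ v)) := by
  obtain ⟨ι, hι⟩ : ∃ ι : RobinSpace hΩ hμ →L[ℝ] L2 Ω,
      ∀ u, ι u = tildeIncl Ω (robinIncl hΩ hμ u) :=
    ⟨(tildeIncl Ω).comp (robinIncl hΩ hμ), fun _ => rfl⟩
  obtain ⟨B, hB⟩ : ∃ B : RobinSpace hΩ hμ →L[ℝ] RobinSpace hΩ hμ →L[ℝ] ℝ, ∀ u v, B u v =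
      innerComp (tildeGrad Ω) (robinIncl hΩ hμ u) (robinIncl hΩ hμ v) +
        c * inner ℝ (robinTrace hΩ hμ u) (robinTrace hΩ hμ v) :=
    ⟨innerComp ((tildeGrad Ω).comp (robinIncl hΩ hμ)) +
      c • innerComp (robinTrace hΩ hμ), fun u v => rfl⟩
  have hd : DenseRange ι := by
    rw [show (ι : RobinSpace hΩ hμ → L2 Ω) = tildeIncl Ω ∘ robinIncl hΩ hμ from funext hι]
    exact (denseRange_tildeIncl hΩ).comp (denseRange_robinIncl hΩ hμ) (tildeIncl Ω).continuous
  have hBself : ∀ u, B u u = ‖tildeGrad Ω (robinIncl hΩ hμ u)‖ ^ 2 +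
      c * ‖robinTrace hΩ hμ u‖ ^ 2 := fun u => by
    rw [hB, innerComp_self, real_inner_self_eq_norm_sq]
  have hcoer : ∀ u, c * ‖u‖ ^ 2 ≤ B u u + ‖ι u‖ ^ 2 := fun u => by
    rw [hBself, hι, norm_sq_robinGraph, norm_sq_tildeGraph]
    have h1 := mul_le_of_le_one_left (sq_nonneg ‖tildeIncl Ω (robinIncl hΩ hμ u)‖) hc1
    have h2 := mul_le_of_le_one_left (sq_nonneg ‖tildeGrad Ω (robinIncl hΩ hμ u)‖) hc1
    linarith
  have hD : robinDomain Ω μ = Set.range ι := by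
    ext u
    rw [mem_robinDomain_iff hΩ hμ]
    exact ⟨fun ⟨p, hp, h⟩ => ⟨⟨p, hp⟩, (hι _).trans h⟩,
      fun ⟨p, h⟩ => ⟨p.1, p.2, (hι p).symm.trans h⟩⟩
  have ha : ∀ u v, dirichletForm Ω (ι u) (ι v) +
      c * ∫ x in frontier Ω, rqcRep Ω (ι u) x * rqcRep Ω (ι v) x ∂μ = B u v := fun u v => by
    rw [hι, hι, dirichletForm_tildeIncl hΩ, integral_rqcRep_mul_rqcRep, hB]
  have hsymm : ∀ u v, B u v = B v u := fun u v => by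
    rw [hB, hB, innerComp_symm, real_inner_comm]
  have hnonneg : ∀ u, 0 ≤ B u u := fun u => by rw [hBself]; positivity
  have := exists_formOperator ι hd B hsymm hnonneg hc hcoer hD
    (a := fun u v => dirichletForm Ω u v +
      c * ∫ x in frontier Ω, rqcRep Ω u x * rqcRep Ω v x ∂μ) ha
  simpa only [hι, hB] using this

end RobinForm

end Robin

end

theorem corollary4p10 (N : ℕ) (Ω : Set (Robin.E N)) (hΩ : IsOpen Ω)
    (μ : Measure (Robin.E N)) (hfin : IsFiniteMeasure μ) (hμ : Robin.IsSmoothMeasure Ω μ) :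
    ∃ (Δμ : ℕ+ → Robin.L2 Ω →ₗ.[ℝ] Robin.L2 Ω) (ΔN : Robin.L2 Ω →ₗ.[ℝ] Robin.L2 Ω),
      (∀ k : ℕ+, IsSelfAdjoint (Δμ k) ∧
        Robin.IsFormOperator (Robin.robinDomain Ω μ)
          (fun u v => Robin.dirichletForm Ω u v +
            (1 / (k : ℝ)) * ∫ x in frontier Ω, Robin.rqcRep Ω u x * Robin.rqcRep Ω v x ∂μ)
          (Δμ k)) ∧
      (IsSelfAdjoint ΔN ∧
        Robin.IsFormOperator (Robin.tildeH1 Ω) (Robin.dirichletForm Ω) ΔN) ∧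
      Robin.StrongResolventTendsto Δμ atTop ΔN := by
  have hk1 : ∀ k : ℕ+, 1 / (k : ℝ) ≤ 1 := fun k => by
    rw [div_le_one (by positivity)]
    exact_mod_cast (one_le : 1 ≤ k)
  choose Δμ hsa hform hres using fun k : ℕ+ =>
    Robin.exists_robin_operator hΩ hμ (c := 1 / (k : ℝ)) (by positivity) (hk1 k)
  obtain ⟨ΔN, hsaN, hformN, hresN⟩ := Robin.exists_neumann_operator hΩ
  refine ⟨Δμ, ΔN, fun k => ⟨hsa k, hform k⟩, ⟨hsaN, hformN⟩, fun α hα => ?_⟩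
  choose R hR hRf using fun k => hres k α hα
  obtain ⟨S, hS, hSf⟩ := hresN α hα
  refine ⟨R, S, hR, hS, fun f => ?_⟩
  choose u hu hu' using fun k => hRf k f
  obtain ⟨u₀, hu₀, hu₀'⟩ := hSf f
  simp only [hu, hu₀]
  -- Coercivity of the Robin forms degenerates as `k → ∞`, but the convergence uses only the limit
  -- form and the density of `𝓕^μ` in `H̃¹(Ω)`.
  exact Robin.tendsto_of_vanishing_perturbation (Robin.tildeIncl Ω)
    (Robin.innerComp (Robin.tildeGrad Ω)) (Robin.innerComp_symm _)
    (Robin.innerComp_self_nonneg _) (Robin.robinIncl hΩ hμ).toLinearMap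
    (Robin.denseRange_robinIncl hΩ hμ)
    ((innerₗ (Robin.L2Bdry Ω μ)).compl₁₂ (Robin.robinTrace hΩ hμ).toLinearMap
      (Robin.robinTrace hΩ hμ).toLinearMap)
    (fun u v => real_inner_comm (Robin.robinTrace hΩ hμ v) (Robin.robinTrace hΩ hμ u))
    (fun u => real_inner_self_nonneg (x := Robin.robinTrace hΩ hμ u)) hα f u u₀ hu' hu₀'
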